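/- Let $G$ be a finite, non-empty, connected simple graph with vertex set $V$, let $t\ge 3$ be an integer, let $\Bbbk$ be a field and let $S=\Bbbk[x_v : v\in V]$. Let $\mathcal C_t(G)\subseteq S$ be the ideal generated by the monomials $\prod_{v\in U}x_v$, where $U$ runs over the sets of $t$ vertices whose induced subgraph in $G$ is connected. For a monomial ideal $I\subseteq S$, the Scarf complex $\operatorname{Scarf}(I)$ is the simplicial complex of all sets $\sigma$ of minimal monomial generators of $I$ such that no other set of minimal monomial generators has the same least common multiple as $\sigma$ (with $\operatorname{lcm}(\varnothing)=1$). Let $\mathcal F_{\operatorname{Scarf}(I)}$ be the complex of free $S$-modules with one basis element $e_\sigma$, in homological degree $|\sigma|$, for each face $\sigma$, and with differential $$e_\sigma\mapsto\sum_{m\in\sigma}\pm\frac{\operatorname{lcm}(\sigma)}{\operatorname{lcm}(\sigma\setminus\{m\})}\,e_{\sigma\setminus\{m\}},$$ where the signs are those of the simplicial boundary map for a fixed linear ordering of the monomials. Then the following are equivalent: (a) $\mathcal F_{\operatorname{Scarf}(\mathcal C_t(G))}$ is a minimal free resolution of $S/\mathcal C_t(G)$; (b) $\mathcal F_{\operatorname{Scarf}(\mathcal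 C_t(G))}$ is a free resolution of $S/\mathcal C_t(G)$; (c) $G$ has at most $t$ vertices, or $G$ is a path $P_r$ on $r$ vertices for some $r\le 2t$. -/

import Mathlib

section MonomialResolutions

open MvPolynomial

/-! Monomials of the polynomial ring `MvPolynomial V k` are identified with their exponent
vectors `V →₀ ℕ`: divisibility is the pointwise order, the least common multiple is the
supremum, and the monomial `1` is the exponent vector `0`. -/

/-- The least common multiple of a finite set of monomials; the lcm of the empty set is `1`. -/
noncomputable def lcmLabel {V : Type*} (σ : Finset (V →₀ ℕ)) : V →₀ ℕ :=
  σ.sup id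

/-- The minimal monomial generators of a monomial ideal `I`: the monomials of `I` that are
minimal with respect to divisibility. -/
def minGens {V k : Type*} [Field k] (I : Ideal (MvPolynomial V k)) : Set (V →₀ ℕ) :=
  {m | Minimal (fun a : V →₀ ℕ => monomial a (1 : k) ∈ I) m}

open Classical in
/-- The Scarf complex of a monomial ideal: the finite sets of minimal generators whose lcm is
not the lcm of any other set of minimal generators. A simplicial complex is here a family of
finite sets that is closed under taking subsets, and the empty set counts as a face. -/
def scarfComplex {V k : Type*} [Field k] (I : Ideal (MvPolynomial V k)) :
    LowerSet (Finset (V →₀ ℕ)) where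
  carrier := {σ | (σ : Set (V →₀ ℕ)) ⊆ minGens I ∧
    ∀ τ : Finset (V →₀ ℕ), (τ : Set (V →₀ ℕ)) ⊆ minGens I → lcmLabel σ = lcmLabel τ → σ = τ}
  lower' := by
    rintro σ τ hτσ ⟨hσ, huniq⟩
    have hsub : (τ : Set (V →₀ ℕ)) ⊆ σ := by exact_mod_cast hτσ
    refine ⟨hsub.trans hσ, fun ρ hρ hlcm => ?_⟩
    have hτσ' : σ = σ \ τ ∪ τ := (Finset.sdiff_union_of_subset hτσ).symm
    have h1 : σ = σ \ τ ∪ ρ := by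
      apply huniq
      · intro x hx
        simp only [Finset.coe_union, Finset.coe_sdiff, Set.mem_union, Set.mem_sdiff] at hx
        rcases hx with hx | hx
        · exact hσ hx.1
        · exact hρ hx
      · conv_lhs => rw [hτσ']
        simp only [lcmLabel, Finset.sup_union] at hlcm ⊢
        rw [hlcm]
    have hρσ : ρ ⊆ σ := by rw [h1]; exact Finset.subset_union_right
    have hτρ : τ ⊆ ρ := by
      intro x hx
      have hxσ : x ∈ σ \ τ ∪ ρ := h1 ▸ hτσ hx
      simp only [Finset.mem_union, Finset.mem_sdiff] at hxσ
      rcases hxσ with h | h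
      · exact absurd hx h.2
      · exact h
    have h2 : σ = σ \ ρ ∪ τ := by
      apply huniq
      · intro x hx
        simp only [Finset.coe_union, Finset.coe_sdiff, Set.mem_union, Set.mem_sdiff] at hx
        rcases hx with hx | hx
        · exact hσ hx.1
        · exact hσ (hsub hx)
      · conv_lhs => rw [(Finset.sdiff_union_of_subset hρσ).symm]
        simp only [lcmLabel, Finset.sup_union] at hlcm ⊢
        rw [hlcm]
    refine Finset.Subset.antisymm hτρ fun x hx => ?_
    have hxσ : x ∈ σ \ ρ ∪ τ := h2 ▸ hρσ hx
    simp only [Finset.mem_union, Finset.mem_sdiff] at hxσ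
    rcases hxσ with h | h
    · exact absurd hx h.2
    · exact h

/-- The faces with exactly `n` vertices (that is, of dimension `n - 1`). -/
abbrev facesOfCard {V : Type*} (Δ : LowerSet (Finset (V →₀ ℕ))) (n : ℕ) : Type _ :=
  {σ : Finset (V →₀ ℕ) // σ ∈ Δ ∧ σ.card = n}

/-- The module in homological degree `n` of the complex `F_Δ`: the free module over the
polynomial ring on the faces with `n` vertices. In degree `0` the only basis element is the
empty face. -/
abbrev cellularModule {V : Type*} (k : Type*) [Field k] (Δ : LowerSet (Finset (V →₀ ℕ)))
    (n : ℕ) : Type _ :=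
  facesOfCard Δ n →₀ MvPolynomial V k

open Classical in
/-- The coefficient of the facet `σ \ {m}` in the boundary of `σ`: the incidence sign, with
respect to the ordering `r` of the vertices, times `lcm(σ) / lcm(σ \ {m})`. The exponents are
subtracted pointwise; as `lcm(σ \ {m})` divides `lcm(σ)` this is the quotient of monomials. -/
noncomputable def boundaryCoeff {V : Type*} (k : Type*) [Field k]
    (r : (V →₀ ℕ) → (V →₀ ℕ) → Prop) (σ : Finset (V →₀ ℕ)) (m : V →₀ ℕ) : MvPolynomial V k :=
  (-1) ^ (σ.filter fun a => r a m).card *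
    monomial (lcmLabel σ - lcmLabel (σ.erase m)) (1 : k)

open Classical in
/-- The facet `σ \ {m}` of a face `σ`. -/
noncomputable def facet {V : Type*} {Δ : LowerSet (Finset (V →₀ ℕ))} {n : ℕ} (σ : facesOfCard Δ (n + 1))
    (m : {m // m ∈ σ.1}) : facesOfCard Δ n :=
  ⟨σ.1.erase m.1, Δ.lower (Finset.erase_subset m.1 σ.1) σ.2.1, by
    rw [Finset.card_erase_of_mem m.2, σ.2.2, Nat.add_sub_cancel]⟩

/-- The differential of `F_Δ` from degree `n + 1` to degree `n`, the homogenization of the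
simplicial boundary map of `Δ`. -/
noncomputable def cellularD {V : Type*} (k : Type*) [Field k]
    (r : (V →₀ ℕ) → (V →₀ ℕ) → Prop) (Δ : LowerSet (Finset (V →₀ ℕ))) (n : ℕ) :
    cellularModule k Δ (n + 1) →ₗ[MvPolynomial V k] cellularModule k Δ n :=
  Finsupp.linearCombination (MvPolynomial V k) fun σ : facesOfCard Δ (n + 1) =>
    ∑ m ∈ σ.1.attach, Finsupp.single (facet σ m) (boundaryCoeff k r σ.1 m.1)

/-- The augmentation from degree `0` of `F_Δ` to `S / I`, sending the empty face to `1`. -/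
noncomputable def cellularAug {V k : Type*} [Field k] (Δ : LowerSet (Finset (V →₀ ℕ)))
    (I : Ideal (MvPolynomial V k)) :
    cellularModule k Δ 0 →ₗ[MvPolynomial V k] (MvPolynomial V k ⧸ I) :=
  Finsupp.linearCombination (MvPolynomial V k) fun _ : facesOfCard Δ 0 =>
    (1 : MvPolynomial V k ⧸ I)

/-- `Δ` supports a resolution of `S / I`: the complex of free modules `F_Δ`, augmented by
`S / I`, is exact. -/
def SupportsResolution {V k : Type*} [Field k] (r : (V →₀ ℕ) → (V →₀ ℕ) → Prop)
    (Δ : LowerSet (Finset (V →₀ ℕ))) (I : Ideal (MvPolynomial V k)) : Prop :=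
  Function.Surjective (cellularAug Δ I) ∧
  Function.Exact (cellularD k r Δ 0) (cellularAug Δ I) ∧
  ∀ n : ℕ, Function.Exact (cellularD k r Δ (n + 1)) (cellularD k r Δ n)

/-- `F_Δ` is a minimal complex: every differential has its image in the irrelevant maximal
ideal times the target. -/
def IsMinimalComplex {V : Type*} (k : Type*) [Field k] (r : (V →₀ ℕ) → (V →₀ ℕ) → Prop)
    (Δ : LowerSet (Finset (V →₀ ℕ))) : Prop :=
  ∀ n : ℕ, LinearMap.range (cellularD k r Δ n) ≤
    Ideal.span (Set.range (X : V → MvPolynomial V k)) •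
      (⊤ : Submodule (MvPolynomial V k) (cellularModule k Δ n))

/-- `I` is Scarf: its Scarf complex supports a resolution of `S / I`. -/
def IsScarf {V k : Type*} [Field k] (r : (V →₀ ℕ) → (V →₀ ℕ) → Prop)
    (I : Ideal (MvPolynomial V k)) : Prop :=
  SupportsResolution r (scarfComplex I) I

/-- `I` is minimally resolved by its Scarf complex: the Scarf complex supports a resolution of
`S / I`, and that resolution is minimal. -/
def IsMinimallyResolvedByScarf {V k : Type*} [Field k] (r : (V →₀ ℕ) → (V →₀ ℕ) → Prop)
    (I : Ideal (MvPolynomial V k)) : Prop :=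
  SupportsResolution r (scarfComplex I) I ∧ IsMinimalComplex k r (scarfComplex I)

/-- The `t`-connected ideal of a graph `G`: the ideal generated by the products of the vertices
of the connected induced subgraphs of `G` with `t` vertices. -/
noncomputable def connectedIdeal {V : Type*} (k : Type*) [Field k] (G : SimpleGraph V) (t : ℕ) :
    Ideal (MvPolynomial V k) :=
  Ideal.span {p | ∃ U : Finset V, U.card = t ∧ (G.induce (U : Set V)).Connected ∧
    p = ∏ v ∈ U, X v}

end MonomialResolutions

/-!
The Scarf complex `Δ` always gives a minimal complex (`isMinimalComplex_scarfComplex`), so only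
exactness is at issue. A set of minimal generators is a Scarf face exactly when it contains every
generator dividing its lcm and none of its elements divides the lcm of the others
(`mem_scarfComplex_iff`). For the connected ideal the generators are the squarefree monomials of
the connected sets of `t` vertices, and divisibility is inclusion of sets.

If `G` is a path on at most `2t` vertices, the generators are its windows of length `t`. Any two
of them overlap or touch, so `Δ` is a path joining consecutive windows. Exactness
is then elementary (`IsGeneratorChain.supportsResolution`): the boundary map on edges is
injective since the edges can be treated in their order along the path, and a syzygy of the
generators is shortened from its last term, because the colon ideal of the earlier generators by
the last one is generated by one monomial, the coefficient of a single edge. The case of at most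
`t` vertices has at most one generator and is an instance of the same lemma.

Conversely, suppose that `Δ` supports a resolution. Comparing coefficients of homogeneous cycles
shows that two generators `p`, `q` force an edge at `p` below `lcm (p, q)`
(`SupportsResolution.exists_edge`), and that an edge closing a cycle of edges lies in a triangle
below the same multidegree (`SupportsResolution.exists_triangle_of_cycle`). By the first fact, no
`t + 1` vertices contain three generators (`IsScarf.not_three_connected`), as their pairwise lcms
would agree. If a vertex had three neighbours, a connected set of `t + 1` vertices grown from it
would have three vertices whose removal leaves it connected; hence `G` has maximum degree at
most two, and a longest path shows that it is a path or a cycle. The second fact rules out paths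
on more than `2t` vertices and, together with the first, all cycles on more than `t` vertices:
consecutive windows form a cycle in `Δ` with an edge in no triangle (`IsScarf.not_long_path`,
`IsScarf.not_cycle`).
-/

/-! ### The boundary maps of the complex of a family of faces -/

section Boundary

open MvPolynomial
open scoped Classical

variable {V k : Type*} [Field k] {r : (V →₀ ℕ) → (V →₀ ℕ) → Prop}
  {Δ : LowerSet (Finset (V →₀ ℕ))} {I : Ideal (MvPolynomial V k)}

theorem cellularD_apply {n : ℕ} (w : cellularModule k Δ (n + 1)) (ρ : facesOfCard Δ n) :
    cellularD k r Δ n w ρ =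
      w.sum fun τ c => c * cellularD k r Δ n (Finsupp.single τ 1) ρ := by
  have h : ∀ τ, cellularD k r Δ n (Finsupp.single τ 1) =
      ∑ m ∈ τ.1.attach, Finsupp.single (facet τ m) (boundaryCoeff k r τ.1 m.1) := by
    intro τ
    rw [cellularD, Finsupp.linearCombination_single, one_smul]
  simp only [h]
  rw [cellularD, Finsupp.linearCombination_apply, Finsupp.sum, Finsupp.sum,
    Finsupp.finsetSum_apply]
  rfl

theorem facet_injective {n : ℕ} (τ : facesOfCard Δ (n + 1)) :
    Function.Injective (facet τ) := by
  intro a b h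
  have h' : τ.1.erase a.1 = τ.1.erase b.1 := congrArg Subtype.val h
  by_contra hne
  have hmem : a.1 ∈ τ.1.erase b.1 :=
    Finset.mem_erase.2 ⟨fun h => hne (Subtype.ext h), a.2⟩
  rw [← h'] at hmem
  exact Finset.notMem_erase _ _ hmem

theorem cellularD_single_apply_facet {n : ℕ} (τ : facesOfCard Δ (n + 1)) (m : {m // m ∈ τ.1}) :
    cellularD k r Δ n (Finsupp.single τ 1) (facet τ m) = boundaryCoeff k r τ.1 m.1 := by
  rw [cellularD, Finsupp.linearCombination_single, one_smul, Finsupp.finsetSum_apply,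
    Finset.sum_eq_single m]
  · simp
  · intro b _ hb
    exact Finsupp.single_eq_of_ne fun h => hb (facet_injective τ h).symm
  · simp

theorem exists_eq_facet_of_cellularD_single_ne_zero {n : ℕ} {τ : facesOfCard Δ (n + 1)}
    {ρ : facesOfCard Δ n} (h : cellularD k r Δ n (Finsupp.single τ 1) ρ ≠ 0) :
    ∃ m : {m // m ∈ τ.1}, ρ = facet τ m := by
  by_contra! hne
  apply h
  rw [cellularD, Finsupp.linearCombination_single, one_smul, Finsupp.finsetSum_apply]
  exact Finset.sum_eq_zero fun m _ => Finsupp.single_eq_of_ne (hne m)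

theorem boundaryCoeff_eq (σ : Finset (V →₀ ℕ)) (m : V →₀ ℕ) :
    boundaryCoeff k r σ m = monomial (lcmLabel σ - lcmLabel (σ.erase m)) (1 : k) ∨
    boundaryCoeff k r σ m = -monomial (lcmLabel σ - lcmLabel (σ.erase m)) (1 : k) := by
  rw [boundaryCoeff]
  rcases neg_one_pow_eq_or (MvPolynomial V k) (σ.filter fun a => r a m).card with h | h <;>
    simp [h]

/-- A term of a boundary in the direction of `ρ` comes from a face `τ` containing `ρ`, and its
multidegree bounds the lcm of `τ`. This reads off the existence of faces from exactness. -/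
theorem exists_face_of_coeff_cellularD_ne_zero {n : ℕ} {w : cellularModule k Δ (n + 1)}
    {ρ : facesOfCard Δ n} {b : V →₀ ℕ} (h : coeff b (cellularD k r Δ n w ρ) ≠ 0) :
    ∃ τ : facesOfCard Δ (n + 1), ρ.1 ⊆ τ.1 ∧ lcmLabel τ.1 ≤ b + lcmLabel ρ.1 := by
  rw [cellularD_apply, Finsupp.sum, coeff_sum] at h
  obtain ⟨τ, -, hτ⟩ := Finset.exists_ne_zero_of_sum_ne_zero h
  have hne : cellularD k r Δ n (Finsupp.single τ 1) ρ ≠ 0 := by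
    intro h0
    simp [h0] at hτ
  obtain ⟨m, rfl⟩ := exists_eq_facet_of_cellularD_single_ne_zero hne
  refine ⟨τ, Finset.erase_subset _ _, ?_⟩
  have hle : lcmLabel τ.1 - lcmLabel (facet τ m).1 ≤ b := by
    by_contra hle
    replace hle : ¬lcmLabel τ.1 - lcmLabel (τ.1.erase m.1) ≤ b := hle
    apply hτ
    rw [cellularD_single_apply_facet]
    rcases boundaryCoeff_eq (k := k) (r := r) τ.1 m.1 with h | h
    · rw [h, coeff_mul_monomial', if_neg hle]
    · rw [h, mul_neg, coeff_neg, coeff_mul_monomial', if_neg hle, neg_zero]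
  exact tsub_le_iff_right.1 hle

/-- The face with the single vertex `p`. -/
abbrev vertexFace {p : V →₀ ℕ} (h : {p} ∈ Δ) : facesOfCard Δ 1 :=
  ⟨{p}, h, Finset.card_singleton p⟩

/-- The face with the two vertices `p` and `q`. -/
noncomputable abbrev edgeFace {p q : V →₀ ℕ} (h : {p, q} ∈ Δ) (hpq : p ≠ q) : facesOfCard Δ 2 :=
  ⟨{p, q}, h, Finset.card_pair hpq⟩

theorem cellularD_vertexFace [IsStrictTotalOrder (V →₀ ℕ) r] {p : V →₀ ℕ} (h : {p} ∈ Δ)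
    (ρ : facesOfCard Δ 0) :
    cellularD k r Δ 0 (Finsupp.single (vertexFace h) 1) ρ = monomial p 1 := by
  have hρ : ρ = facet (vertexFace h) ⟨p, Finset.mem_singleton_self p⟩ := by
    apply Subtype.ext
    rw [Finset.card_eq_zero.1 ρ.2.2]
    simp [facet]
  rw [hρ, cellularD_single_apply_facet, boundaryCoeff,
    Finset.filter_singleton, if_neg (irrefl p)]
  simp [lcmLabel, bot_eq_zero]

theorem cellularD_zero_single_apply [IsStrictTotalOrder (V →₀ ℕ) r] (τ : facesOfCard Δ 1)
    (ρ : facesOfCard Δ 0) :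
    cellularD k r Δ 0 (Finsupp.single τ 1) ρ = monomial (lcmLabel τ.1) 1 := by
  obtain ⟨p, hp⟩ := Finset.card_eq_one.1 τ.2.2
  obtain ⟨σ, h⟩ := τ
  obtain rfl : σ = {p} := hp
  rw [lcmLabel, Finset.sup_singleton]
  exact cellularD_vertexFace h.1 ρ

/-- The boundary of an edge is the difference of its ends, up to a sign depending on the order. -/
theorem cellularD_edgeFace [IsStrictTotalOrder (V →₀ ℕ) r] {p q : V →₀ ℕ} (h : {p, q} ∈ Δ)
    (hpq : p ≠ q) (hp : {p} ∈ Δ) (hq : {q} ∈ Δ) :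
    ∃ ε : MvPolynomial V k, (ε = 1 ∨ ε = -1) ∧
      cellularD k r Δ 1 (Finsupp.single (edgeFace h hpq) 1) =
        ε • (Finsupp.single (vertexFace hq) (monomial (p ⊔ q - q) 1) -
          Finsupp.single (vertexFace hp) (monomial (p ⊔ q - p) 1)) := by
  have hep : ({p, q} : Finset (V →₀ ℕ)).erase p = {q} := by
    ext x; simp only [Finset.mem_erase, Finset.mem_insert, Finset.mem_singleton]; grind
  have heq : ({p, q} : Finset (V →₀ ℕ)).erase q = {p} := by
    ext x; simp only [Finset.mem_erase, Finset.mem_insert, Finset.mem_singleton]; grind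
  have hfp : facet (edgeFace h hpq) ⟨p, by simp⟩ = vertexFace hq := Subtype.ext hep
  have hfq : facet (edgeFace h hpq) ⟨q, by simp⟩ = vertexFace hp := Subtype.ext heq
  have hatt : ({p, q} : Finset (V →₀ ℕ)).attach = {⟨p, by simp⟩, ⟨q, by simp⟩} := by
    ext ⟨x, hx⟩
    simp only [Finset.mem_attach, Finset.mem_insert, Finset.mem_singleton, Subtype.mk.injEq,
      true_iff]
    simpa using hx
  have hd : cellularD k r Δ 1 (Finsupp.single (edgeFace h hpq) 1) =
      Finsupp.single (vertexFace hq) (boundaryCoeff k r {p, q} p) +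
        Finsupp.single (vertexFace hp) (boundaryCoeff k r {p, q} q) := by
    rw [cellularD, Finsupp.linearCombination_single, one_smul]
    change ∑ m ∈ ({p, q} : Finset (V →₀ ℕ)).attach, _ = _
    rw [hatt, Finset.sum_pair (by simpa using hpq)]
    rw [hfp, hfq]
  rw [hd]
  simp only [boundaryCoeff, hep, heq, Finset.filter_insert, Finset.filter_singleton, irrefl,
    if_false, lcmLabel, Finset.sup_insert, Finset.sup_singleton, id]
  rcases trichotomous_of r p q with hr | hr | hr
  · refine ⟨1, Or.inl rfl, ?_⟩
    simp [hr, asymm hr, sub_eq_add_neg, Finsupp.single_neg]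
  · exact absurd hr hpq
  · refine ⟨-1, Or.inr rfl, ?_⟩
    simp [hr, asymm hr, sub_eq_add_neg, Finsupp.single_neg, add_comm]

theorem cellularD_zero_comp_cellularD_one [IsStrictTotalOrder (V →₀ ℕ) r] :
    cellularD k r Δ 0 ∘ₗ cellularD k r Δ 1 = 0 := by
  refine Finsupp.lhom_ext' fun τ => LinearMap.ext_ring ?_
  obtain ⟨p, q, hpq, hσ⟩ := Finset.card_eq_two.1 τ.2.2
  obtain ⟨σ, h⟩ := τ
  obtain rfl : σ = {p, q} := hσ
  have hp : {p} ∈ Δ := Δ.lower (by simp) h.1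
  have hq : {q} ∈ Δ := Δ.lower (by simp) h.1
  obtain ⟨ε, -, hd⟩ := cellularD_edgeFace (k := k) (r := r) h.1 hpq hp hq
  simp only [LinearMap.comp_apply, Finsupp.lsingle_apply, LinearMap.zero_apply]
  rw [hd, ← mul_one (monomial (p ⊔ q - q) 1), ← mul_one (monomial (p ⊔ q - p) 1),
    ← smul_eq_mul, ← smul_eq_mul, ← Finsupp.smul_single, ← Finsupp.smul_single, map_smul,
    map_sub, map_smul, map_smul]
  ext1 ρ
  rw [Finsupp.smul_apply, Finsupp.sub_apply, Finsupp.smul_apply, Finsupp.smul_apply,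
    cellularD_vertexFace, cellularD_vertexFace, smul_eq_mul, smul_eq_mul, smul_eq_mul,
    monomial_mul, monomial_mul, tsub_add_cancel_of_le le_sup_left, tsub_add_cancel_of_le le_sup_right]
  simp

/-- The boundary of an edge, homogenized to any multidegree `a` above its lcm. -/
theorem exists_cellularD_edgeFace_eq [IsStrictTotalOrder (V →₀ ℕ) r] {p q a : V →₀ ℕ}
    (h : {p, q} ∈ Δ) (hpq : p ≠ q) (hp : {p} ∈ Δ) (hq : {q} ∈ Δ) (ha : p ⊔ q ≤ a) :
    ∃ ε : MvPolynomial V k, (ε = 1 ∨ ε = -1) ∧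
      cellularD k r Δ 1 (Finsupp.single (edgeFace h hpq) (ε * monomial (a - p ⊔ q) 1)) =
        Finsupp.single (vertexFace hq) (monomial (a - q) 1) -
          Finsupp.single (vertexFace hp) (monomial (a - p) 1) := by
  obtain ⟨ε, hε, hd⟩ := cellularD_edgeFace (k := k) (r := r) h hpq hp hq
  refine ⟨ε, hε, ?_⟩
  have hε2 : ε * ε = 1 := by rcases hε with rfl | rfl <;> simp
  rw [← mul_one (ε * _), ← smul_eq_mul, ← Finsupp.smul_single, map_smul, hd, smul_smul,
    mul_right_comm, hε2, one_mul, smul_sub, Finsupp.smul_single, Finsupp.smul_single,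
    smul_eq_mul, smul_eq_mul, monomial_mul, monomial_mul, one_mul,
    tsub_add_tsub_cancel ha le_sup_right, tsub_add_tsub_cancel ha le_sup_left]

/-- A path of edges from `p` to `x` below the multidegree `a` and avoiding `e` gives a
homogeneous 1-chain bounding the difference of its ends in which `e` does not occur. -/
theorem exists_chain_of_reflTransGen [IsStrictTotalOrder (V →₀ ℕ) r] {p x a : V →₀ ℕ}
    (hp : {p} ∈ Δ) (e : facesOfCard Δ 2)
    (h : Relation.ReflTransGen
      (fun x y => x ≠ y ∧ {x, y} ∈ Δ ∧ x ⊔ y ≤ a ∧ {x, y} ≠ e.1) p x) :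
    ∃ (hx : {x} ∈ Δ) (w : cellularModule k Δ 2), w e = 0 ∧
      cellularD k r Δ 1 w = Finsupp.single (vertexFace hx) (monomial (a - x) 1) -
          Finsupp.single (vertexFace hp) (monomial (a - p) 1) := by
  induction h with
  | refl => exact ⟨hp, 0, by simp⟩
  | @tail x y _ hxy ih =>
    obtain ⟨hx, w, hw, hd⟩ := ih
    obtain ⟨hne, hface, ha, he⟩ := hxy
    have hy : {y} ∈ Δ := Δ.lower (by simp) hface
    obtain ⟨ε, -, hε⟩ := exists_cellularD_edgeFace_eq (k := k) (r := r) hface hne hx hy ha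
    refine ⟨hy, w + Finsupp.single (edgeFace hface hne) (ε * monomial (a - x ⊔ y) 1), ?_, ?_⟩
    · rw [Finsupp.add_apply, hw, zero_add]
      exact Finsupp.single_eq_of_ne fun h => he (congrArg Subtype.val h).symm
    · rw [map_add, hd, hε]
      abel

end Boundary

/-! ### Scarf complexes -/

section Scarf

open MvPolynomial
open scoped Classical

variable {V k : Type*} [Field k] {r : (V →₀ ℕ) → (V →₀ ℕ) → Prop} {I : Ideal (MvPolynomial V k)}

theorem eq_of_mem_minGens_of_le {p q : V →₀ ℕ} (hp : p ∈ minGens I) (hq : q ∈ minGens I)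
    (h : p ≤ q) : p = q :=
  le_antisymm h (hq.2 hp.1 h)

theorem lcmLabel_mono {σ τ : Finset (V →₀ ℕ)} (h : σ ⊆ τ) : lcmLabel σ ≤ lcmLabel τ :=
  Finset.sup_mono h

theorem le_lcmLabel {σ : Finset (V →₀ ℕ)} {m : V →₀ ℕ} (h : m ∈ σ) : m ≤ lcmLabel σ :=
  Finset.le_sup (f := id) h

/-- A set of minimal generators is a Scarf face when it contains every generator dividing its
lcm and none of its elements divides the lcm of the others. -/
theorem mem_scarfComplex_iff {σ : Finset (V →₀ ℕ)} :
    σ ∈ scarfComplex I ↔ (σ : Set (V →₀ ℕ)) ⊆ minGens I ∧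
      (∀ m ∈ minGens I, m ≤ lcmLabel σ → m ∈ σ) ∧
      ∀ m ∈ σ, ¬m ≤ lcmLabel (σ.erase m) := by
  change (_ ∧ _) ↔ _
  refine and_congr_right fun hσ => ⟨fun h => ⟨fun m hm hle => ?_, fun m hm hle => ?_⟩, ?_⟩
  · have := h (insert m σ) (by
      intro x hx
      rcases Finset.mem_insert.1 (Finset.mem_coe.1 hx) with rfl | hx
      exacts [hm, hσ hx]) (by
        rw [lcmLabel, lcmLabel, Finset.sup_insert, id]
        exact (sup_eq_right.2 hle).symm)
    rw [this]
    exact Finset.mem_insert_self _ _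
  · have := h (σ.erase m) ((Finset.coe_subset.2 (Finset.erase_subset _ _)).trans hσ) (by
      conv_lhs => rw [← Finset.insert_erase hm]
      rw [lcmLabel, lcmLabel, Finset.sup_insert, id]
      exact sup_eq_right.2 hle)
    rw [this] at hm
    exact Finset.notMem_erase _ _ hm
  · rintro ⟨h1, h2⟩ τ hτ hlcm
    have hτσ : τ ⊆ σ := fun m hm => h1 m (hτ hm) (hlcm ▸ le_lcmLabel hm)
    refine (Finset.Subset.antisymm hτσ fun m hm => ?_).symm
    by_contra hmτ
    refine h2 m hm ((le_lcmLabel hm).trans (hlcm ▸ lcmLabel_mono ?_))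
    exact fun x hx => Finset.mem_erase.2 ⟨fun h => hmτ (h ▸ hx), hτσ hx⟩

theorem empty_mem_scarfComplex (h0 : 0 ∉ minGens I) : ∅ ∈ scarfComplex I := by
  refine mem_scarfComplex_iff.2 ⟨by simp, fun m hm hle => ?_, by simp⟩
  rw [lcmLabel, Finset.sup_empty, le_bot_iff] at hle
  rw [hle] at hm
  exact absurd hm h0

theorem singleton_mem_scarfComplex (h0 : 0 ∉ minGens I) {p : V →₀ ℕ} (hp : p ∈ minGens I) :
    {p} ∈ scarfComplex I := by
  refine mem_scarfComplex_iff.2 ⟨by simpa using hp, fun m hm hle => ?_, fun m hm hle => ?_⟩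
  · rw [lcmLabel, Finset.sup_singleton] at hle
    exact Finset.mem_singleton.2 (eq_of_mem_minGens_of_le hm hp hle)
  · obtain rfl := Finset.mem_singleton.1 hm
    rw [Finset.erase_singleton, lcmLabel, Finset.sup_empty, le_bot_iff] at hle
    rw [hle] at hp
    exact h0 hp

theorem pair_mem_scarfComplex_iff {p q : V →₀ ℕ} (hp : p ∈ minGens I) (hq : q ∈ minGens I)
    (hpq : p ≠ q) : {p, q} ∈ scarfComplex I ↔
      ∀ m ∈ minGens I, m ≤ p ⊔ q → m = p ∨ m = q := by
  have hl : lcmLabel {p, q} = p ⊔ q := by simp [lcmLabel]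
  rw [mem_scarfComplex_iff, hl]
  refine ⟨fun h m hm hle => by simpa using h.2.1 m hm hle, fun h => ⟨?_, ?_, ?_⟩⟩
  · simp [Set.insert_subset_iff, hp, hq]
  · simpa using h
  · intro m hm hle
    rcases Finset.mem_insert.1 hm with rfl | hm
    · rw [Finset.erase_insert (by simpa using hpq), lcmLabel, Finset.sup_singleton] at hle
      exact hpq (eq_of_mem_minGens_of_le hp hq hle)
    · obtain rfl := Finset.mem_singleton.1 hm
      rw [Finset.pair_comm, Finset.erase_insert (by simpa using hpq.symm), lcmLabel,
        Finset.sup_singleton] at hle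
      exact hpq (eq_of_mem_minGens_of_le hq hp hle).symm

/-- The complex of a Scarf complex is always minimal: in a Scarf face no vertex divides the lcm
of the others, so no coefficient of the differential is a unit. -/
theorem isMinimalComplex_scarfComplex : IsMinimalComplex k r (scarfComplex I) := by
  intro n
  rw [cellularD, Finsupp.range_linearCombination, Submodule.span_le]
  rintro _ ⟨σ, rfl⟩
  refine Submodule.sum_mem _ fun m _ => ?_
  have hmem : boundaryCoeff k r σ.1 m.1 ∈ Ideal.span (Set.range (X : V → MvPolynomial V k)) := by
    rw [boundaryCoeff]
    refine Ideal.mul_mem_left _ _ ?_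
    have hne : lcmLabel σ.1 - lcmLabel (σ.1.erase m.1) ≠ 0 := fun h0 =>
      (mem_scarfComplex_iff.1 σ.2.1).2.2 m.1 m.2
        ((le_lcmLabel m.2).trans (tsub_eq_zero_iff_le.1 h0))
    obtain ⟨v, hv⟩ := Finsupp.ne_iff.1 hne
    rw [← Set.image_univ, mem_ideal_span_X_image]
    intro d hd
    rw [Finset.mem_singleton.1 (support_monomial_subset hd)]
    exact ⟨v, Set.mem_univ _, hv⟩
  rw [← mul_one (boundaryCoeff k r σ.1 m.1), ← smul_eq_mul, ← Finsupp.smul_single]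
  exact Submodule.smul_mem_smul hmem trivial

/-- Exactness in homological degree one: every minimal generator `p` lies on an edge below its
lcm with any other generator. -/
theorem SupportsResolution.exists_edge [IsStrictTotalOrder (V →₀ ℕ) r]
    (h : SupportsResolution r (scarfComplex I) I) (h0 : 0 ∉ minGens I) {p q : V →₀ ℕ}
    (hp : p ∈ minGens I) (hq : q ∈ minGens I) (hpq : p ≠ q) :
    ∃ m ∈ minGens I, m ≠ p ∧ m ≤ p ⊔ q ∧ {p, m} ∈ scarfComplex I := by
  have hpΔ := singleton_mem_scarfComplex h0 hp
  have hqΔ := singleton_mem_scarfComplex h0 hq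
  set y : cellularModule k (scarfComplex I) 1 :=
    Finsupp.single (vertexFace hpΔ) (monomial (p ⊔ q - p) 1) -
      Finsupp.single (vertexFace hqΔ) (monomial (p ⊔ q - q) 1) with hy
  have hy0 : cellularD k r (scarfComplex I) 0 y = 0 := by
    ext1 ρ
    rw [hy, ← mul_one (monomial (p ⊔ q - p) 1), ← mul_one (monomial (p ⊔ q - q) 1),
      ← smul_eq_mul, ← smul_eq_mul, ← Finsupp.smul_single, ← Finsupp.smul_single, map_sub,
      map_smul, map_smul, Finsupp.sub_apply, Finsupp.smul_apply, Finsupp.smul_apply,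
      cellularD_vertexFace, cellularD_vertexFace, smul_eq_mul, smul_eq_mul, monomial_mul,
      monomial_mul, tsub_add_cancel_of_le le_sup_left, tsub_add_cancel_of_le le_sup_right]
    simp
  obtain ⟨w, hw⟩ := (h.2.2 0 y).1 hy0
  have hne : vertexFace hpΔ ≠ vertexFace hqΔ := fun h =>
    hpq (Finset.singleton_injective (congrArg Subtype.val h))
  obtain ⟨τ, hτ, hle⟩ := exists_face_of_coeff_cellularD_ne_zero (w := w)
    (ρ := vertexFace hpΔ) (b := p ⊔ q - p) (by
      rw [hw, hy, Finsupp.sub_apply, Finsupp.single_eq_same, Finsupp.single_eq_of_ne hne]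
      simp)
  rw [lcmLabel, lcmLabel, Finset.sup_singleton, id, tsub_add_cancel_of_le le_sup_left] at hle
  obtain ⟨m, hm, hmp⟩ := Finset.exists_mem_ne (by rw [τ.2.2]; norm_num) p
  have hpτ : p ∈ τ.1 := hτ (Finset.mem_singleton_self p)
  refine ⟨m, (mem_scarfComplex_iff.1 τ.2.1).1 hm, hmp, (le_lcmLabel hm).trans hle, ?_⟩
  have hsub : {p, m} ⊆ τ.1 := by simp [Finset.insert_subset_iff, hpτ, hm]
  exact (scarfComplex I).lower hsub τ.2.1

/-- Exactness in homological degree two: an edge `{p, q}` that closes a path of other edges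
lies in a triangle, and all of this happens below a given multidegree `a`. -/
theorem SupportsResolution.exists_triangle [IsStrictTotalOrder (V →₀ ℕ) r]
    (h : SupportsResolution r (scarfComplex I) I) {p q a : V →₀ ℕ} (hpq : p ≠ q)
    (he : {p, q} ∈ scarfComplex I) (ha : p ⊔ q ≤ a)
    (hpath : Relation.ReflTransGen
      (fun x y => x ≠ y ∧ {x, y} ∈ scarfComplex I ∧ x ⊔ y ≤ a ∧
        ({x, y} : Finset (V →₀ ℕ)) ≠ {p, q}) p q) :
    ∃ m, m ≠ p ∧ m ≠ q ∧ m ≤ a ∧ {p, q, m} ∈ scarfComplex I := by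
  have hp : {p} ∈ scarfComplex I := (scarfComplex I).lower (by simp) he
  obtain ⟨hq, w, hw0, hw⟩ :=
    exists_chain_of_reflTransGen (k := k) (r := r) hp (edgeFace he hpq) hpath
  obtain ⟨ε, hε, hd⟩ := exists_cellularD_edgeFace_eq (k := k) (r := r) he hpq hp hq ha
  obtain ⟨v, hv⟩ := (h.2.2 1 (Finsupp.single (edgeFace he hpq)
    (ε * monomial (a - p ⊔ q) 1) - w)).1 (by rw [map_sub, hd, hw, sub_self])
  obtain ⟨τ, hτ, hle⟩ := exists_face_of_coeff_cellularD_ne_zero (w := v)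
    (ρ := edgeFace he hpq) (b := a - p ⊔ q) (by
      rw [hv, Finsupp.sub_apply, Finsupp.single_eq_same, hw0]
      rcases hε with rfl | rfl <;> simp)
  have hl : lcmLabel {p, q} = p ⊔ q := by simp [lcmLabel]
  rw [hl, tsub_add_cancel_of_le ha] at hle
  obtain ⟨m, hm, hmpq⟩ : ∃ m ∈ τ.1, m ∉ ({p, q} : Finset (V →₀ ℕ)) := by
    by_contra! hcon
    have := Finset.card_le_card hcon
    rw [τ.2.2, Finset.card_pair hpq] at this
    omega
  rw [Finset.mem_insert, Finset.mem_singleton, not_or] at hmpq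
  refine ⟨m, hmpq.1, hmpq.2, (le_lcmLabel hm).trans hle, (scarfComplex I).lower ?_ τ.2.1⟩
  have h1 : p ∈ τ.1 := hτ (by simp)
  have h2 : q ∈ τ.1 := hτ (by simp)
  change {p, q, m} ⊆ τ.1
  simp [Finset.insert_subset_iff, h1, h2, hm]

/-- A cycle of edges `p 0, …, p m` below a multidegree `a` forces a triangle on its last edge. -/
theorem SupportsResolution.exists_triangle_of_cycle [IsStrictTotalOrder (V →₀ ℕ) r]
    (h : SupportsResolution r (scarfComplex I) I) {p : ℕ → V →₀ ℕ} {a : V →₀ ℕ} {m : ℕ}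
    (hm : 2 ≤ m) (hinj : Set.InjOn p (Set.Iic m))
    (hedge : ∀ i < m, {p i, p (i + 1)} ∈ scarfComplex I) (ha : ∀ i ≤ m, p i ≤ a)
    (hlast : {p 0, p m} ∈ scarfComplex I) :
    ∃ x, x ≠ p 0 ∧ x ≠ p m ∧ x ≤ a ∧ {p 0, p m, x} ∈ scarfComplex I := by
  have hne : ∀ {i j}, i ≤ m → j ≤ m → i ≠ j → p i ≠ p j := fun hi hj hij heq =>
    hij (hinj hi hj heq)
  refine h.exists_triangle (hne (Nat.zero_le m) le_rfl (by omega)) hlast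
    (sup_le (ha 0 (Nat.zero_le m)) (ha m le_rfl)) ?_
  have key : ∀ j ≤ m, Relation.ReflTransGen
      (fun x y => x ≠ y ∧ {x, y} ∈ scarfComplex I ∧ x ⊔ y ≤ a ∧
        ({x, y} : Finset (V →₀ ℕ)) ≠ {p 0, p m}) (p 0) (p j) := by
    intro j hj
    induction j with
    | zero => exact Relation.ReflTransGen.refl
    | succ j ih =>
      refine (ih (by omega)).tail ⟨hne (by omega) hj (by omega), hedge j hj,
        sup_le (ha j (by omega)) (ha _ hj), fun heq => ?_⟩
      have h0 : p 0 ∈ ({p j, p (j + 1)} : Finset (V →₀ ℕ)) := by simp [heq]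
      have h1 : p m ∈ ({p j, p (j + 1)} : Finset (V →₀ ℕ)) := by simp [heq]
      rw [Finset.mem_insert, Finset.mem_singleton] at h0 h1
      have h0' : 0 = j := by
        rcases h0 with h0 | h0
        · exact hinj (Nat.zero_le m) (by simp; omega) h0
        · exact absurd (hinj (Nat.zero_le m) hj h0) (by omega)
      have h1' : m = j + 1 := by
        rcases h1 with h1 | h1
        · exact absurd (hinj (Set.mem_Iic.2 le_rfl) (by simp; omega) h1) (by omega)
        · exact hinj (Set.mem_Iic.2 le_rfl) hj h1
      omega
  exact key m le_rfl

end Scarf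

/-! ### Ideals whose generators form a chain -/

section Chain

open MvPolynomial
open scoped Classical

variable {V k : Type*} [Field k] {r : (V →₀ ℕ) → (V →₀ ℕ) → Prop} {I : Ideal (MvPolynomial V k)}

theorem cellularAug_surjective (h0 : 0 ∉ minGens I) :
    Function.Surjective (cellularAug (scarfComplex I) I) := by
  intro s
  obtain ⟨s, rfl⟩ := Ideal.Quotient.mk_surjective s
  refine ⟨Finsupp.single ⟨∅, empty_mem_scarfComplex h0, Finset.card_empty⟩ s, ?_⟩
  rw [cellularAug, Finsupp.linearCombination_single]
  exact congrArg (Ideal.Quotient.mk I) (mul_one s)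

theorem exact_cellularD_zero_cellularAug [IsStrictTotalOrder (V →₀ ℕ) r] (h0 : 0 ∉ minGens I)
    (hspan : Ideal.span ((fun m => monomial m (1 : k)) '' minGens I) = I) :
    Function.Exact (cellularD k r (scarfComplex I) 0) (cellularAug (scarfComplex I) I) := by
  let e : facesOfCard (scarfComplex I) 0 := ⟨∅, empty_mem_scarfComplex h0, Finset.card_empty⟩
  have he : ∀ ρ : facesOfCard (scarfComplex I) 0, ρ = e := fun ρ =>
    Subtype.ext (Finset.card_eq_zero.1 ρ.2.2)
  have hy : ∀ y : cellularModule k (scarfComplex I) 0, y = Finsupp.single e (y e) := by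
    intro y
    ext1 ρ
    rw [he ρ, Finsupp.single_eq_same]
  have hd : ∀ τ : facesOfCard (scarfComplex I) 1,
      cellularD k r (scarfComplex I) 0 (Finsupp.single τ 1) =
        Finsupp.single e (monomial (lcmLabel τ.1) 1) := by
    intro τ
    rw [hy (cellularD k r (scarfComplex I) 0 (Finsupp.single τ 1)), cellularD_zero_single_apply]
  have haug : ∀ s : MvPolynomial V k, cellularAug (scarfComplex I) I (Finsupp.single e s) = 0 ↔
      s ∈ I := by
    intro s
    rw [cellularAug, Finsupp.linearCombination_single]
    change Ideal.Quotient.mk I (s * 1) = 0 ↔ _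
    rw [mul_one, Ideal.Quotient.eq_zero_iff_mem]
  rw [LinearMap.exact_iff]
  refine le_antisymm (fun y hker => ?_) ?_
  · rw [LinearMap.mem_ker, hy y, haug] at hker
    rw [hy y]
    have hle : Ideal.span ((fun m => monomial m (1 : k)) '' minGens I) ≤
        (LinearMap.range (cellularD k r (scarfComplex I) 0)).comap (Finsupp.lsingle e) := by
      refine Submodule.span_le.2 ?_
      rintro _ ⟨m, hm, rfl⟩
      refine ⟨Finsupp.single (vertexFace (singleton_mem_scarfComplex h0 hm)) 1, ?_⟩
      rw [hd]
      simp [lcmLabel]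
    exact hle (hspan.symm.le hker)
  · rw [LinearMap.range_le_ker_iff]
    refine Finsupp.lhom_ext' fun τ => LinearMap.ext_ring ?_
    simp only [LinearMap.comp_apply, Finsupp.lsingle_apply, LinearMap.zero_apply]
    rw [hd, haug]
    obtain ⟨p, hp⟩ := Finset.card_eq_one.1 τ.2.2
    rw [hp, lcmLabel, Finset.sup_singleton]
    exact ((mem_scarfComplex_iff.1 τ.2.1).1 (by simp [hp] : p ∈ τ.1)).1

/-- The minimal generators of `I` are `P 0, …, P (q - 1)`, every lcm of two of them is a multiple
of the generators in between, and that of two consecutive ones of no further generator. -/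
structure IsGeneratorChain (I : Ideal (MvPolynomial V k)) (P : ℕ → V →₀ ℕ) (q : ℕ) : Prop where
  minGens_eq : minGens I = P '' Set.Iio q
  injOn : Set.InjOn P (Set.Iio q)
  le_sup : ∀ ⦃i m j⦄, i ≤ m → m ≤ j → j < q → P m ≤ P i ⊔ P j
  eq_or_eq : ∀ ⦃i m⦄, i + 1 < q → m < q → P m ≤ P i ⊔ P (i + 1) → m = i ∨ m = i + 1

namespace IsGeneratorChain

variable {P : ℕ → V →₀ ℕ} {q : ℕ}

theorem mem_minGens (h : IsGeneratorChain I P q) {i : ℕ} (hi : i < q) : P i ∈ minGens I := by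
  rw [h.minGens_eq]
  exact ⟨i, hi, rfl⟩

theorem ne (h : IsGeneratorChain I P q) {i j : ℕ} (hi : i < q) (hj : j < q) (hij : i ≠ j) :
    P i ≠ P j := fun heq => hij (h.injOn hi hj heq)

theorem eq_succ_of_mem_face (h : IsGeneratorChain I P q) {σ : Finset (V →₀ ℕ)}
    (hσ : σ ∈ scarfComplex I) {i j : ℕ} (hij : i < j) (hj : j < q) (hiσ : P i ∈ σ)
    (hjσ : P j ∈ σ) : j = i + 1 := by
  by_contra hne
  have hle : P (i + 1) ≤ P i ⊔ P j := h.le_sup (by omega) (by omega) hj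
  obtain ⟨-, h1, h2⟩ := mem_scarfComplex_iff.1 hσ
  have hm : P (i + 1) ∈ σ := h1 _ (h.mem_minGens (by omega))
    (hle.trans (sup_le (le_lcmLabel hiσ) (le_lcmLabel hjσ)))
  refine h2 _ hm (hle.trans (sup_le (le_lcmLabel ?_) (le_lcmLabel ?_)))
  · exact Finset.mem_erase.2 ⟨h.ne (by omega) (by omega) (by omega), hiσ⟩
  · exact Finset.mem_erase.2 ⟨h.ne (by omega) (by omega) (by omega), hjσ⟩

theorem exists_index (h : IsGeneratorChain I P q) {σ : Finset (V →₀ ℕ)}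
    (hσ : σ ∈ scarfComplex I) {p : V →₀ ℕ} (hp : p ∈ σ) : ∃ i < q, P i = p := by
  have := (mem_scarfComplex_iff.1 hσ).1 hp
  rwa [h.minGens_eq] at this

theorem isEmpty_facesOfCard (h : IsGeneratorChain I P q) {n : ℕ} (hn : 3 ≤ n) :
    IsEmpty (facesOfCard (scarfComplex I) n) := by
  refine ⟨fun σ => ?_⟩
  have hcard : 2 < σ.1.card := by rw [σ.2.2]; omega
  obtain ⟨a, ha, b, hb, c, hc, hab, hac, hbc⟩ := Finset.two_lt_card.1 hcard
  obtain ⟨i, hi, rfl⟩ := h.exists_index σ.2.1 ha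
  obtain ⟨j, hj, rfl⟩ := h.exists_index σ.2.1 hb
  obtain ⟨l, hl, rfl⟩ := h.exists_index σ.2.1 hc
  have key : ∀ {x y}, x < q → y < q → P x ∈ σ.1 → P y ∈ σ.1 → P x ≠ P y →
      y = x + 1 ∨ x = y + 1 := by
    intro x y hx hy hxσ hyσ hne
    rcases lt_trichotomy x y with hlt | rfl | hlt
    · exact Or.inl (h.eq_succ_of_mem_face σ.2.1 hlt hy hxσ hyσ)
    · exact absurd rfl hne
    · exact Or.inr (h.eq_succ_of_mem_face σ.2.1 hlt hx hyσ hxσ)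
  have h1 := key hi hj ha hb hab
  have h2 := key hi hl ha hc hac
  have h3 := key hj hl hb hc hbc
  omega

theorem pair_mem (h : IsGeneratorChain I P q) {i : ℕ} (hi : i + 1 < q) :
    {P i, P (i + 1)} ∈ scarfComplex I := by
  rw [pair_mem_scarfComplex_iff (h.mem_minGens (by omega)) (h.mem_minGens hi)
    (h.ne (by omega) hi (by omega))]
  intro m hm hle
  rw [h.minGens_eq] at hm
  obtain ⟨j, hj, rfl⟩ := hm
  rcases h.eq_or_eq hi hj hle with rfl | rfl
  exacts [Or.inl rfl, Or.inr rfl]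

theorem exists_eq_pair (h : IsGeneratorChain I P q) (τ : facesOfCard (scarfComplex I) 2) :
    ∃ i, i + 1 < q ∧ τ.1 = {P i, P (i + 1)} := by
  obtain ⟨a, b, hab, hτ⟩ := Finset.card_eq_two.1 τ.2.2
  have ha : a ∈ τ.1 := by simp [hτ]
  have hb : b ∈ τ.1 := by simp [hτ]
  obtain ⟨i, hi, rfl⟩ := h.exists_index τ.2.1 ha
  obtain ⟨j, hj, rfl⟩ := h.exists_index τ.2.1 hb
  rcases lt_trichotomy i j with hlt | rfl | hlt
  · obtain rfl := h.eq_succ_of_mem_face τ.2.1 hlt hj ha hb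
    exact ⟨i, hj, hτ⟩
  · exact absurd rfl hab
  · obtain rfl := h.eq_succ_of_mem_face τ.2.1 hlt hi hb ha
    exact ⟨j, hi, by rw [hτ, Finset.pair_comm]⟩

/-- The differential from edges to vertices is injective: the edges are ordered along a path,
so the coefficients of a cycle vanish one after the other. -/
theorem ker_cellularD_one (h : IsGeneratorChain I P q)
    {z : cellularModule k (scarfComplex I) 2}
    (hz : cellularD k r (scarfComplex I) 1 z = 0) : z = 0 := by
  have key : ∀ i, ∀ τ : facesOfCard (scarfComplex I) 2, i + 1 < q →
      τ.1 = {P i, P (i + 1)} → z τ = 0 := by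
    intro i
    induction i using Nat.strong_induction_on with
    | _ i ih =>
    intro τ hi hτ
    have hmem : P (i + 1) ∈ τ.1 := by simp [hτ]
    have hfacet : (facet τ ⟨P (i + 1), hmem⟩).1 = {P i} := by
      change τ.1.erase (P (i + 1)) = _
      rw [hτ, Finset.pair_comm, Finset.erase_insert]
      simpa using h.ne hi (by omega) (by omega)
    have hcoord := DFunLike.congr_fun hz (facet τ ⟨P (i + 1), hmem⟩)
    rw [cellularD_apply, Finsupp.sum, Finset.sum_eq_single τ,
      cellularD_single_apply_facet] at hcoord
    · rcases mul_eq_zero.1 hcoord with h | h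
      · exact h
      · rcases boundaryCoeff_eq (k := k) (r := r) τ.1 (P (i + 1)) with h' | h' <;>
          simp [h'] at h
    · intro ρ _ hρ
      obtain ⟨j, hj, hρj⟩ := h.exists_eq_pair ρ
      rcases lt_trichotomy j i with hlt | rfl | hlt
      · rw [ih j hlt ρ hj hρj, zero_mul]
      · exact absurd (Subtype.ext (hρj.trans hτ.symm)) hρ
      · by_contra hne
        obtain ⟨m, hm⟩ := exists_eq_facet_of_cellularD_single_ne_zero (right_ne_zero_of_mul hne)
        have hsub : {P i} ⊆ ρ.1 := by
          rw [← hfacet, hm]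
          exact Finset.erase_subset _ _
        rw [Finset.singleton_subset_iff, hρj, Finset.mem_insert, Finset.mem_singleton] at hsub
        rcases hsub with hs | hs
        · exact h.ne (by omega) (by omega) (by omega) hs
        · exact h.ne (by omega) (by omega) (by omega) hs
    · intro hτz
      rw [Finsupp.notMem_support_iff.1 hτz, zero_mul]
  ext1 τ
  obtain ⟨i, hi, hτ⟩ := h.exists_eq_pair τ
  exact key i τ hi hτ

/-- A syzygy of `P 0, …, P j` has its last coefficient divisible by
`lcm (P (j - 1), P j) / P j`, as that monomial generates the colon ideal of the earlier
generators by `P j`; subtracting a multiple of the boundary of the last edge shortens it. -/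
theorem ker_cellularD_zero_le_range [IsStrictTotalOrder (V →₀ ℕ) r]
    (h : IsGeneratorChain I P q) (h0 : 0 ∉ minGens I) :
    LinearMap.ker (cellularD k r (scarfComplex I) 0) ≤
      LinearMap.range (cellularD k r (scarfComplex I) 1) := by
  have hface : ∀ {i}, i < q → {P i} ∈ scarfComplex I := fun hi =>
    singleton_mem_scarfComplex h0 (h.mem_minGens hi)
  have hvertex : ∀ τ : facesOfCard (scarfComplex I) 1, ∃ i, ∃ hi : i < q,
      τ = vertexFace (hface hi) := by
    intro τ
    obtain ⟨p, hp⟩ := Finset.card_eq_one.1 τ.2.2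
    obtain ⟨i, hi, rfl⟩ := h.exists_index τ.2.1 (by simp [hp] : p ∈ τ.1)
    exact ⟨i, hi, Subtype.ext hp⟩
  have key : ∀ j ≤ q, ∀ y : cellularModule k (scarfComplex I) 1,
      cellularD k r (scarfComplex I) 0 y = 0 →
      (∀ i, j ≤ i → ∀ hi : i < q, y (vertexFace (hface hi)) = 0) →
      y ∈ LinearMap.range (cellularD k r (scarfComplex I) 1) := by
    intro j
    induction j with
    | zero =>
      intro _ y _ hy
      have : y = 0 := by
        ext1 τ
        obtain ⟨i, hi, rfl⟩ := hvertex τ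
        exact hy i (Nat.zero_le i) hi
      rw [this]
      exact Submodule.zero_mem _
    | succ j ih =>
      intro hj y hd hy
      have hjq : j < q := hj
      set τ := vertexFace (hface hjq) with hτ
      -- The last term of the relation lies in the ideal of the earlier generators.
      have hspan : y τ * monomial (P j) 1 ∈
          Ideal.span ((fun m => monomial m (1 : k)) '' (P '' Set.Iio j)) := by
        let e : facesOfCard (scarfComplex I) 0 :=
          ⟨∅, empty_mem_scarfComplex h0, Finset.card_empty⟩
        have hcoord := DFunLike.congr_fun hd e
        rw [cellularD_apply, ← Finsupp.add_sum_erase' _ τ _ (by simp),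
          cellularD_zero_single_apply, Finsupp.zero_apply, hτ, lcmLabel, Finset.sup_singleton,
          id, add_eq_zero_iff_eq_neg] at hcoord
        rw [hcoord]
        refine Submodule.neg_mem _ (Submodule.sum_mem _ fun ρ hρ => ?_)
        rw [Finsupp.support_erase, Finset.mem_erase] at hρ
        obtain ⟨i, hi, rfl⟩ := hvertex ρ
        have hij : i < j := by
          by_contra hle
          rcases eq_or_ne i j with rfl | hne
          · exact hρ.1 rfl
          · exact Finsupp.mem_support_iff.1 hρ.2 (hy i (by omega) hi)
        refine Ideal.mul_mem_left _ _ (Ideal.subset_span ?_)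
        rw [cellularD_zero_single_apply, lcmLabel, Finset.sup_singleton]
        exact ⟨P i, ⟨i, hij, rfl⟩, rfl⟩
      rw [mem_ideal_span_monomial_image] at hspan
      obtain rfl | hj0 := Nat.eq_zero_or_pos j
      · refine ih (Nat.zero_le _) y hd fun i _ hi => ?_
        obtain rfl | hi0 := Nat.eq_zero_or_pos i
        · have hz : y τ * monomial (P 0) 1 = 0 := by
            by_contra hne
            obtain ⟨b, hb⟩ := (support_nonempty).2 hne
            obtain ⟨_, ⟨l, hl, rfl⟩, _⟩ := hspan b hb
            exact absurd hl (Nat.not_lt_zero l)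
          exact (mul_eq_zero.1 hz).resolve_right (by simp)
        · exact hy i hi0 hi
      · obtain ⟨j, rfl⟩ : ∃ l, j = l + 1 := ⟨j - 1, by omega⟩
        have hj' : j < q := by omega
        have hdvd : monomial (P j ⊔ P (j + 1)) (1 : k) ∣ y τ * monomial (P (j + 1)) 1 := by
          rw [← Ideal.mem_span_singleton, ← Set.image_singleton (f := fun m => monomial m (1 : k)),
            mem_ideal_span_monomial_image]
          intro b hb
          obtain ⟨_, ⟨i, hi, rfl⟩, hib⟩ := hspan b hb
          refine ⟨_, rfl, ?_⟩
          have hb2 : P (j + 1) ≤ b := by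
            by_contra hle
            rw [mem_support_iff, coeff_mul_monomial', if_neg hle] at hb
            exact hb rfl
          exact sup_le ((h.le_sup (Nat.lt_succ_iff.1 hi) (Nat.le_succ j) hjq).trans
            (sup_le hib hb2)) hb2
        obtain ⟨c, hc⟩ := hdvd
        have hyc : y τ = monomial (P j ⊔ P (j + 1) - P (j + 1)) 1 * c := by
          have hm : monomial (P (j + 1)) (1 : k) ≠ 0 := by simp
          apply mul_right_cancel₀ hm
          rw [hc, mul_right_comm, monomial_mul, one_mul,
            tsub_add_cancel_of_le le_sup_right]
        have hne : P j ≠ P (j + 1) := h.ne hj' hjq (by omega)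
        obtain ⟨ε, hε, hdE⟩ := cellularD_edgeFace (k := k) (r := r) (h.pair_mem hjq) hne
          (hface hj') (hface hjq)
        have hε2 : ε * ε = 1 := by rcases hε with rfl | rfl <;> simp
        set E : cellularModule k (scarfComplex I) 2 :=
          (ε * c) • Finsupp.single (edgeFace (h.pair_mem hjq) hne) 1 with hE
        have hdE' : cellularD k r (scarfComplex I) 1 E = c • (Finsupp.single τ
            (monomial (P j ⊔ P (j + 1) - P (j + 1)) 1) - Finsupp.single (vertexFace (hface hj'))
            (monomial (P j ⊔ P (j + 1) - P j) 1)) := by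
          rw [hE, map_smul, hdE, smul_smul, mul_right_comm, hε2, one_mul]
        have hsub : y - cellularD k r (scarfComplex I) 1 E ∈
            LinearMap.range (cellularD k r (scarfComplex I) 1) := by
          refine ih (by omega) _ ?_ fun i hji hi => ?_
          · rw [map_sub, hd, ← LinearMap.comp_apply, cellularD_zero_comp_cellularD_one,
              LinearMap.zero_apply, sub_zero]
          · have hvne : ∀ {l} (hl : l < q), i ≠ l →
                vertexFace (hface hi) ≠ vertexFace (hface hl) := fun hl hil heq =>
              h.ne hi hl hil (Finset.singleton_injective (congrArg Subtype.val heq))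
            rw [hdE', Finsupp.sub_apply, Finsupp.smul_apply, Finsupp.sub_apply,
              Finsupp.single_eq_of_ne (hvne hj' (by omega)), sub_zero, smul_eq_mul]
            rcases eq_or_ne i (j + 1) with rfl | hij
            · rw [Finsupp.single_eq_same, hyc, mul_comm, sub_self]
            · rw [Finsupp.single_eq_of_ne (hvne hjq hij), hy i (by omega) hi, mul_zero, sub_zero]
        have := Submodule.add_mem _ hsub (LinearMap.mem_range_self _ E)
        rwa [sub_add_cancel] at this
  exact fun y hy => key q le_rfl y hy fun i h1 h2 => absurd h2 (not_lt.2 h1)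

/-- An ideal whose generators form a chain is resolved by its Scarf complex, which is a path. -/
theorem supportsResolution [IsStrictTotalOrder (V →₀ ℕ) r] (h : IsGeneratorChain I P q)
    (h0 : 0 ∉ minGens I)
    (hspan : Ideal.span ((fun m => monomial m (1 : k)) '' minGens I) = I) :
    SupportsResolution r (scarfComplex I) I := by
  refine ⟨cellularAug_surjective h0, exact_cellularD_zero_cellularAug h0 hspan, fun n => ?_⟩
  rw [LinearMap.exact_iff]
  match n with
  | 0 =>
    exact le_antisymm (h.ker_cellularD_zero_le_range h0)
      (LinearMap.range_le_ker_iff.2 cellularD_zero_comp_cellularD_one)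
  | 1 =>
    have := h.isEmpty_facesOfCard le_rfl
    refine le_antisymm (fun z hz => ?_) ?_
    · rw [h.ker_cellularD_one hz]
      exact Submodule.zero_mem _
    · rintro _ ⟨w, rfl⟩
      rw [Subsingleton.elim w 0, map_zero]
      exact Submodule.zero_mem _
  | n + 2 =>
    have := h.isEmpty_facesOfCard (show 3 ≤ n + 2 + 1 by omega)
    exact le_antisymm (fun z _ => Subsingleton.elim 0 z ▸ Submodule.zero_mem _)
      fun z _ => Subsingleton.elim 0 z ▸ Submodule.zero_mem _

end IsGeneratorChain

end Chain

/-! ### The generators of connected ideals -/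

section ConnectedIdeal

open MvPolynomial
open scoped Classical

variable {V : Type*}

/-- The exponent vector of the squarefree monomial `∏ v ∈ U, x_v`. -/
noncomputable def squarefreeExp (U : Finset V) : V →₀ ℕ :=
  ∑ v ∈ U, Finsupp.single v 1

theorem squarefreeExp_apply (U : Finset V) (v : V) :
    squarefreeExp U v = if v ∈ U then 1 else 0 := by
  rw [squarefreeExp, Finsupp.finsetSum_apply]
  simp [Finsupp.single_apply]

theorem squarefreeExp_le_iff {U W : Finset V} : squarefreeExp U ≤ squarefreeExp W ↔ U ⊆ W := by
  constructor
  · intro h v hv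
    by_contra hw
    have := h v
    rw [squarefreeExp_apply, squarefreeExp_apply, if_pos hv, if_neg hw] at this
    omega
  · intro h v
    rw [squarefreeExp_apply, squarefreeExp_apply]
    by_cases hv : v ∈ U
    · rw [if_pos hv, if_pos (h hv)]
    · rw [if_neg hv]
      exact Nat.zero_le _

theorem squarefreeExp_injective : Function.Injective (squarefreeExp (V := V)) := fun _ _ h =>
  Finset.Subset.antisymm (squarefreeExp_le_iff.1 h.le) (squarefreeExp_le_iff.1 h.ge)

theorem squarefreeExp_sup (U W : Finset V) :
    squarefreeExp U ⊔ squarefreeExp W = squarefreeExp (U ∪ W) := by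
  ext v
  rw [Finsupp.sup_apply, squarefreeExp_apply, squarefreeExp_apply, squarefreeExp_apply]
  by_cases h1 : v ∈ U <;> by_cases h2 : v ∈ W <;> simp [h1, h2]

/-- `U` is a set of `t` vertices inducing a connected subgraph. -/
def IsConnectedOfCard (G : SimpleGraph V) (t : ℕ) (U : Finset V) : Prop :=
  U.card = t ∧ (G.induce (U : Set V)).Connected

variable {k : Type*} [Field k] {G : SimpleGraph V} {t : ℕ}

theorem IsConnectedOfCard.eq_of_subset {U W : Finset V} (hU : IsConnectedOfCard G t U)
    (hW : IsConnectedOfCard G t W) (h : U ⊆ W) : U = W :=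
  Finset.eq_of_subset_of_card_le h (by rw [hU.1, hW.1])

theorem connectedIdeal_eq_span : connectedIdeal k G t = Ideal.span
    ((fun m => monomial m (1 : k)) '' (squarefreeExp '' {U | IsConnectedOfCard G t U})) := by
  rw [connectedIdeal, Set.image_image]
  congr 1
  ext p
  simp only [Set.mem_ofPred_eq, Set.mem_image, IsConnectedOfCard, and_assoc]
  refine exists_congr fun U => and_congr_right fun _ => and_congr_right fun _ => ?_
  rw [squarefreeExp, monomial_sum_one, eq_comm]
  rfl

theorem minGens_connectedIdeal :
    minGens (connectedIdeal k G t) = squarefreeExp '' {U | IsConnectedOfCard G t U} := by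
  have hmem : ∀ a : V →₀ ℕ, monomial a (1 : k) ∈ connectedIdeal k G t ↔
      ∃ U, IsConnectedOfCard G t U ∧ squarefreeExp U ≤ a := by
    intro a
    rw [connectedIdeal_eq_span, mem_ideal_span_monomial_image, support_monomial,
      if_neg one_ne_zero]
    simp
  ext a
  simp only [minGens, Set.mem_ofPred_eq, hmem, Set.mem_image]
  constructor
  · rintro ⟨⟨U, hU, hle⟩, hmin⟩
    exact ⟨U, hU, le_antisymm hle (hmin ⟨U, hU, le_rfl⟩ hle)⟩
  · rintro ⟨U, hU, rfl⟩
    refine ⟨⟨U, hU, le_rfl⟩, ?_⟩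
    rintro b ⟨W, hW, hle⟩ hb
    rw [← hW.eq_of_subset hU (squarefreeExp_le_iff.1 (hle.trans hb))]
    exact hle

theorem span_minGens_connectedIdeal :
    Ideal.span ((fun m => monomial m (1 : k)) '' minGens (connectedIdeal k G t)) =
      connectedIdeal k G t := by
  rw [minGens_connectedIdeal, connectedIdeal_eq_span]

theorem IsConnectedOfCard.mem_minGens {U : Finset V} (hU : IsConnectedOfCard G t U) :
    squarefreeExp U ∈ minGens (connectedIdeal k G t) := by
  rw [minGens_connectedIdeal]
  exact ⟨U, hU, rfl⟩

theorem exists_of_mem_minGens {m : V →₀ ℕ} (hm : m ∈ minGens (connectedIdeal k G t)) :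
    ∃ U, IsConnectedOfCard G t U ∧ squarefreeExp U = m := by
  rwa [minGens_connectedIdeal] at hm

theorem zero_notMem_minGens_connectedIdeal (ht : t ≠ 0) :
    0 ∉ minGens (connectedIdeal k G t) := by
  intro h
  obtain ⟨U, hU, h0⟩ := exists_of_mem_minGens h
  have : U ⊆ ∅ := squarefreeExp_le_iff.1 (h0.le.trans zero_le)
  rw [Finset.subset_empty.1 this] at hU
  exact ht hU.1.symm

theorem pair_mem_scarfComplex_connectedIdeal_iff {A B : Finset V}
    (hA : IsConnectedOfCard G t A) (hB : IsConnectedOfCard G t B) (hAB : A ≠ B) :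
    {squarefreeExp A, squarefreeExp B} ∈ scarfComplex (connectedIdeal k G t) ↔
      ∀ C, IsConnectedOfCard G t C → C ⊆ A ∪ B → C = A ∨ C = B := by
  rw [pair_mem_scarfComplex_iff hA.mem_minGens hB.mem_minGens
    (squarefreeExp_injective.ne hAB), minGens_connectedIdeal, Set.forall_mem_image]
  simp only [squarefreeExp_sup, squarefreeExp_le_iff, squarefreeExp_injective.eq_iff]
  rfl

theorem eq_or_eq_or_eq_of_triple_mem {A B C D : Finset V}
    (h : {squarefreeExp A, squarefreeExp B, squarefreeExp C} ∈
      scarfComplex (connectedIdeal k G t))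
    (hD : IsConnectedOfCard G t D) (hsub : D ⊆ A ∪ (B ∪ C)) : D = A ∨ D = B ∨ D = C := by
  have := (mem_scarfComplex_iff.1 h).2.1 _ hD.mem_minGens (by
    simp only [lcmLabel, Finset.sup_insert, Finset.sup_singleton, id, squarefreeExp_sup]
    exact squarefreeExp_le_iff.2 hsub)
  simpa [squarefreeExp_injective.eq_iff] using this

theorem not_subset_of_triple_mem {A B C : Finset V}
    (h : {squarefreeExp A, squarefreeExp B, squarefreeExp C} ∈
      scarfComplex (connectedIdeal k G t)) (hAB : A ≠ B) (hAC : A ≠ C) : ¬A ⊆ B ∪ C := by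
  intro hsub
  refine (mem_scarfComplex_iff.1 h).2.2 (squarefreeExp A) (by simp) ?_
  rw [Finset.erase_insert (by simp [squarefreeExp_injective.eq_iff, hAB, hAC])]
  simp only [lcmLabel, Finset.sup_insert, Finset.sup_singleton, id, squarefreeExp_sup]
  exact squarefreeExp_le_iff.2 hsub

variable {r : (V →₀ ℕ) → (V →₀ ℕ) → Prop} [IsStrictTotalOrder (V →₀ ℕ) r]

theorem IsConnectedOfCard.union_eq {A B H : Finset V} (hA : IsConnectedOfCard G t A)
    (hB : IsConnectedOfCard G t B) (hAB : A ≠ B) (hAH : A ⊆ H) (hBH : B ⊆ H)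
    (hH : H.card = t + 1) : A ∪ B = H := by
  refine Finset.eq_of_subset_of_card_le (Finset.union_subset hAH hBH) ?_
  rw [hH, Nat.succ_le_iff, ← hA.1]
  refine Finset.card_lt_card (Finset.ssubset_iff_subset_ne.2 ⟨Finset.subset_union_left, ?_⟩)
  intro h
  exact hAB (hB.eq_of_subset hA (h ▸ Finset.subset_union_right)).symm

/-- Three generators in the same `t + 1` vertices have the same pairwise lcms, so none of the
edges between them is in the Scarf complex, which is then disconnected in that multidegree. -/
theorem IsScarf.not_three_connected (hS : IsScarf r (connectedIdeal k G t)) (ht : t ≠ 0)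
    {A B C H : Finset V} (hH : H.card = t + 1) (hA : IsConnectedOfCard G t A)
    (hB : IsConnectedOfCard G t B) (hC : IsConnectedOfCard G t C) (hAH : A ⊆ H) (hBH : B ⊆ H)
    (hCH : C ⊆ H) (hAB : A ≠ B) (hAC : A ≠ C) (hBC : B ≠ C) : False := by
  obtain ⟨m, hm, hne, hle, hface⟩ := hS.exists_edge (zero_notMem_minGens_connectedIdeal ht)
    hA.mem_minGens hB.mem_minGens (squarefreeExp_injective.ne hAB)
  obtain ⟨D, hD, rfl⟩ := exists_of_mem_minGens hm
  have hAD : A ≠ D := fun h => hne (h ▸ rfl)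
  rw [squarefreeExp_sup, squarefreeExp_le_iff] at hle
  have hunion := hA.union_eq hD hAD hAH (hle.trans (Finset.union_subset hAH hBH)) hH
  rw [pair_mem_scarfComplex_connectedIdeal_iff hA hD hAD, hunion] at hface
  have h1 := (hface B hB hBH).resolve_left hAB.symm
  have h2 := (hface C hC hCH).resolve_left hAC.symm
  exact hBC (h1.trans h2.symm)

theorem IsScarf.pair_mem (hS : IsScarf r (connectedIdeal k G t)) (ht : t ≠ 0)
    {A B H : Finset V} (hH : H.card = t + 1) (hA : IsConnectedOfCard G t A)
    (hB : IsConnectedOfCard G t B) (hAH : A ⊆ H) (hBH : B ⊆ H) (hAB : A ≠ B) :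
    {squarefreeExp A, squarefreeExp B} ∈ scarfComplex (connectedIdeal k G t) := by
  rw [pair_mem_scarfComplex_connectedIdeal_iff hA hB hAB]
  intro C hC hsub
  by_contra! h
  exact hS.not_three_connected ht hH hA hB hC hAH hBH
    (hsub.trans (Finset.union_subset hAH hBH)) hAB h.1.symm h.2.symm

end ConnectedIdeal

/-! ### Connected vertex sets -/

section Graph

open scoped Classical

variable {V : Type*} {G : SimpleGraph V}

theorem SimpleGraph.Connected.exists_adj_mem_notMem (h : G.Connected) {S : Set V} {u v : V}
    (hu : u ∈ S) (hv : v ∉ S) : ∃ x ∈ S, ∃ y ∉ S, G.Adj x y := by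
  obtain ⟨p⟩ := h.preconnected u v
  obtain ⟨d, -, h1, h2⟩ := p.exists_boundary_dart S hu hv
  exact ⟨d.fst, h1, d.snd, h2, d.adj⟩

theorem exists_adj_of_induce_connected {U : Finset V} (h : (G.induce (U : Set V)).Connected)
    {S : Set V} {u v : V} (huU : u ∈ U) (hvU : v ∈ U) (hu : u ∈ S) (hv : v ∉ S) :
    ∃ x ∈ U, x ∈ S ∧ ∃ y ∈ U, y ∉ S ∧ G.Adj x y := by
  obtain ⟨x, hx, y, hy, hxy⟩ := h.exists_adj_mem_notMem (S := Subtype.val ⁻¹' S)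
    (u := ⟨u, huU⟩) (v := ⟨v, hvU⟩) hu hv
  exact ⟨x.1, x.2, hx, y.1, y.2, hy, hxy⟩

theorem induce_singleton_connected (v : V) :
    (G.induce (({v} : Finset V) : Set V)).Connected := by
  rw [Finset.coe_singleton]
  exact SimpleGraph.Connected.of_subsingleton

theorem induce_insert_connected {U : Finset V} (h : (G.induce (U : Set V)).Connected) {u w : V}
    (hu : u ∈ U) (huw : G.Adj u w) : (G.induce ((insert w U : Finset V) : Set V)).Connected := by
  have heq : ((insert w U : Finset V) : Set V) = (U : Set V) ∪ {u, w} := by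
    ext x
    simp only [Finset.coe_insert, Set.mem_insert_iff, Finset.mem_coe, Set.mem_union,
      Set.mem_singleton_iff]
    grind
  rw [heq]
  exact SimpleGraph.induce_union_connected h.preconnected
    (SimpleGraph.induce_pair_connected_of_adj huw).preconnected ⟨u, hu, Set.mem_insert _ _⟩

variable [Fintype V] {k : Type*} [Field k] {r : (V →₀ ℕ) → (V →₀ ℕ) → Prop}
  [IsStrictTotalOrder (V →₀ ℕ) r] {t : ℕ}

/-- A vertex set of size `n` grown from a claw around `v` one adjacent vertex at a time
still has three vertices whose removal leaves it connected. -/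
theorem exists_connected_of_three_neighbors (hG : G.Connected) {v a b c : V} (hva : G.Adj v a)
    (hvb : G.Adj v b) (hvc : G.Adj v c) (hab : a ≠ b) (hac : a ≠ c) (hbc : b ≠ c) {n : ℕ}
    (hn : 4 ≤ n) (hnV : n ≤ Fintype.card V) :
    ∃ H N : Finset V, H.card = n ∧ (G.induce (H : Set V)).Connected ∧ N ⊆ H ∧ 3 ≤ N.card ∧
      ∀ x ∈ N, (G.induce ((H.erase x : Finset V) : Set V)).Connected := by
  induction n, hn using Nat.le_induction with
  | base =>
    have hcherry : ∀ {x y}, G.Adj v x → G.Adj v y →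
        (G.induce (({y, x, v} : Finset V) : Set V)).Connected := fun hx hy =>
      induce_insert_connected (u := v)
        (induce_insert_connected (induce_singleton_connected v) (by simp) hx) (by simp) hy
    have ha := hva.ne
    have hb := hvb.ne
    have hc := hvc.ne
    refine ⟨{c, b, a, v}, {a, b, c}, ?_, ?_, ?_, ?_, ?_⟩
    · simp [hab.symm, hac.symm, hbc.symm, ha.symm, hb.symm, hc.symm]
    · exact induce_insert_connected (u := v) (hcherry hva hvb) (by simp) hvc
    · intro x
      simp only [Finset.mem_insert, Finset.mem_singleton]
      grind
    · rw [Finset.card_eq_three.2 ⟨a, b, c, hab, hac, hbc, rfl⟩]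
    · intro x hx
      simp only [Finset.mem_insert, Finset.mem_singleton] at hx
      rcases hx with rfl | rfl | rfl
      · rw [show ({c, b, x, v} : Finset V).erase x = {c, b, v} by grind]
        exact hcherry hvb hvc
      · rw [show ({c, x, a, v} : Finset V).erase x = {c, a, v} by grind]
        exact hcherry hva hvc
      · rw [show ({x, b, a, v} : Finset V).erase x = {b, a, v} by grind]
        exact hcherry hva hvb
  | succ n hn ih =>
    obtain ⟨H, N, hH, hconn, hNH, hN, hcut⟩ := ih (by omega)
    obtain ⟨z, hz⟩ : ∃ z, z ∉ H := by
      by_contra! hall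
      rw [Finset.eq_univ_of_forall hall, Finset.card_univ] at hH
      omega
    obtain ⟨y, hy⟩ : H.Nonempty := Finset.card_pos.1 (by omega)
    obtain ⟨u, hu, w, hw, huw⟩ := hG.exists_adj_mem_notMem (S := (H : Set V)) hy hz
    replace hw : w ∉ H := hw
    -- The new vertex `w` takes the place of its neighbour `u` among the removable vertices.
    refine ⟨insert w H, insert w (N.erase u), ?_, induce_insert_connected hconn hu huw,
      Finset.insert_subset_insert _ ((Finset.erase_subset _ _).trans hNH), ?_, ?_⟩
    · rw [Finset.card_insert_of_notMem hw, hH]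
    · rw [Finset.card_insert_of_notMem fun h => hw (hNH (Finset.mem_of_mem_erase h))]
      have := Finset.pred_card_le_card_erase (s := N) (a := u)
      omega
    · intro x hx
      rcases Finset.mem_insert.1 hx with rfl | hx
      · rwa [Finset.erase_insert hw]
      · have hxN := Finset.mem_of_mem_erase hx
        have hxw : w ≠ x := fun h => hw (h ▸ hNH hxN)
        rw [Finset.erase_insert_of_ne hxw]
        exact induce_insert_connected (hcut x hxN)
          (Finset.mem_erase.2 ⟨(Finset.ne_of_mem_erase hx).symm, hu⟩) huw

theorem IsScarf.not_three_neighbors (hS : IsScarf r (connectedIdeal k G t)) (hG : G.Connected)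
    (ht : 3 ≤ t) (htV : t + 1 ≤ Fintype.card V) {v a b c : V} (hva : G.Adj v a)
    (hvb : G.Adj v b) (hvc : G.Adj v c) (hab : a ≠ b) (hac : a ≠ c) (hbc : b ≠ c) : False := by
  obtain ⟨H, N, hH, -, hNH, hN, hcut⟩ := exists_connected_of_three_neighbors hG hva hvb hvc
    hab hac hbc (show 4 ≤ t + 1 by omega) htV
  obtain ⟨x, hx, y, hy, z, hz, hxy, hxz, hyz⟩ := Finset.two_lt_card.1 hN
  have hconn : ∀ {x}, x ∈ N → IsConnectedOfCard G t (H.erase x) := fun hx =>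
    ⟨by rw [Finset.card_erase_of_mem (hNH hx), hH, Nat.add_sub_cancel], hcut _ hx⟩
  have hne : ∀ {x y}, x ∈ N → x ≠ y → H.erase x ≠ H.erase y := fun hx hxy heq =>
    Finset.notMem_erase _ _ (heq ▸ Finset.mem_erase.2 ⟨hxy, hNH hx⟩)
  exact hS.not_three_connected (by omega) hH (hconn hx) (hconn hy) (hconn hz)
    (Finset.erase_subset _ _) (Finset.erase_subset _ _) (Finset.erase_subset _ _)
    (hne hx hxy) (hne hx hxz) (hne hy hyz)

end Graph

/-! ### Windows of a path -/

section Window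

open scoped Classical

variable {V : Type*} {G : SimpleGraph V} {t : ℕ}

/-- The vertices at the `t` positions `i, …, i + t - 1` of the sequence `f`. -/
noncomputable def window (f : ℕ → V) (i t : ℕ) : Finset V :=
  (Finset.Ico i (i + t)).image f

theorem mem_window {f : ℕ → V} {i : ℕ} {v : V} :
    v ∈ window f i t ↔ ∃ j, (i ≤ j ∧ j < i + t) ∧ f j = v := by
  simp [window]

theorem apply_mem_window {f : ℕ → V} {i j : ℕ} (h1 : i ≤ j) (h2 : j < i + t) :
    f j ∈ window f i t :=
  mem_window.2 ⟨j, ⟨h1, h2⟩, rfl⟩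

theorem apply_mem_window_iff {f : ℕ → V} {n i j : ℕ} (hinj : Set.InjOn f (Set.Iio n))
    (hi : i + t ≤ n) (hj : j < n) : f j ∈ window f i t ↔ i ≤ j ∧ j < i + t := by
  rw [mem_window]
  refine ⟨?_, fun h => ⟨j, h, rfl⟩⟩
  rintro ⟨l, hl, heq⟩
  rwa [← hinj (show l ∈ Set.Iio n by rw [Set.mem_Iio]; omega) hj heq]

theorem window_subset_window (f : ℕ → V) {i j s : ℕ} (h1 : j ≤ i) (h2 : i + t ≤ j + s) :
    window f i t ⊆ window f j s :=
  Finset.image_subset_image (Finset.Ico_subset_Ico h1 h2)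

theorem card_window {f : ℕ → V} {i : ℕ} (hinj : Set.InjOn f (Set.Ico i (i + t))) :
    (window f i t).card = t := by
  rw [window, Finset.card_image_of_injOn (by simpa using hinj)]
  simp

theorem window_succ (f : ℕ → V) (i t : ℕ) :
    window f i (t + 1) = insert (f (i + t)) (window f i t) := by
  rw [window, window, ← Finset.image_insert]
  congr 1
  ext x
  simp only [Finset.mem_Ico, Finset.mem_insert]
  omega

theorem induce_window_connected {f : ℕ → V} {i : ℕ} (ht : 1 ≤ t)
    (hadj : ∀ j, i ≤ j → j + 1 < i + t → G.Adj (f j) (f (j + 1))) :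
    (G.induce (window f i t : Set V)).Connected := by
  induction t, ht using Nat.le_induction with
  | base =>
    rw [show window f i 1 = {f i} by simp [window]]
    exact induce_singleton_connected _
  | succ t ht ih =>
    obtain ⟨s, rfl⟩ : ∃ s, t = s + 1 := ⟨t - 1, by omega⟩
    rw [window_succ]
    exact induce_insert_connected (ih fun j h1 h2 => hadj j h1 (by omega))
      (apply_mem_window (j := i + s) (by omega) (by omega)) (hadj _ (by omega) (by omega))

theorem isConnectedOfCard_window {f : ℕ → V} {i : ℕ} (ht : 1 ≤ t)
    (hinj : Set.InjOn f (Set.Ico i (i + t)))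
    (hadj : ∀ j, i ≤ j → j + 1 < i + t → G.Adj (f j) (f (j + 1))) :
    IsConnectedOfCard G t (window f i t) :=
  ⟨card_window hinj, induce_window_connected ht hadj⟩

theorem window_injOn {f : ℕ → V} {n : ℕ} (ht : 1 ≤ t) (hinj : Set.InjOn f (Set.Iio n)) {i j : ℕ}
    (hi : i + t ≤ n) (hj : j + t ≤ n) (h : window f i t = window f j t) : i = j := by
  have h1 : f i ∈ window f j t := h ▸ apply_mem_window le_rfl (by omega)
  have h2 : f j ∈ window f i t := h ▸ apply_mem_window le_rfl (by omega)
  rw [apply_mem_window_iff hinj hj (by omega)] at h1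
  rw [apply_mem_window_iff hinj hi (by omega)] at h2
  omega

end Window

/-! ### Paths on at most `2t` vertices -/

section Path

open scoped Classical

variable {V : Type*} {k : Type*} [Field k] {G : SimpleGraph V} {t n : ℕ} {f : ℕ → V}

/-- The connected `t`-sets of a path are its windows. -/
theorem IsConnectedOfCard.exists_eq_window (ht : 1 ≤ t) (hinj : Set.InjOn f (Set.Iio n))
    (hsurj : ∀ v, ∃ i < n, f i = v)
    (hstep : ∀ i j, i < j → j < n → G.Adj (f i) (f j) → j = i + 1) {U : Finset V}
    (hU : IsConnectedOfCard G t U) : ∃ i, i + t ≤ n ∧ U = window f i t := by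
  set T := (Finset.range n).filter fun i => f i ∈ U with hT
  have hmemT : ∀ {i}, i ∈ T ↔ i < n ∧ f i ∈ U := by simp [hT]
  obtain ⟨v, hv⟩ : U.Nonempty := Finset.card_pos.1 (by rw [hU.1]; omega)
  obtain ⟨x, hx, rfl⟩ := hsurj v
  have hTne : T.Nonempty := ⟨x, hmemT.2 ⟨hx, hv⟩⟩
  set a := T.min' hTne
  set b := T.max' hTne
  have ha : a ∈ T := T.min'_mem hTne
  have hb : b ∈ T := T.max'_mem hTne
  have hab : a ≤ b := T.min'_le b hb
  have hbetween : ∀ j, a ≤ j → j ≤ b → f j ∈ U := by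
    intro j haj hjb
    by_contra hj
    have hbn := (hmemT.1 hb).1
    obtain ⟨_, hxU, ⟨x, hx, rfl⟩, y, hyU, hy, hxy⟩ := exists_adj_of_induce_connected hU.2
      (S := f '' Set.Iio j) (hmemT.1 ha).2 (hmemT.1 hb).2
      ⟨a, lt_of_le_of_ne haj fun h => hj (h ▸ (hmemT.1 ha).2), rfl⟩ (by
        rintro ⟨l, hl, heq⟩
        rw [Set.mem_Iio] at hl
        have := hinj (show l ∈ Set.Iio n by rw [Set.mem_Iio]; omega) hbn heq
        omega)
    obtain ⟨y, hyn, rfl⟩ := hsurj y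
    rw [Set.mem_Iio] at hx
    have hyj : ¬y < j := fun h => hy ⟨y, h, rfl⟩
    have hne : y ≠ j := fun h => hj (h ▸ hyU)
    have := hstep x y (by omega) hyn hxy
    omega
  have hUeq : U = window f a (b + 1 - a) := by
    ext v
    rw [mem_window]
    constructor
    · intro hv
      obtain ⟨i, hi, rfl⟩ := hsurj v
      have hiT : i ∈ T := hmemT.2 ⟨hi, hv⟩
      have h1 := T.min'_le i hiT
      have h2 := T.le_max' i hiT
      exact ⟨i, ⟨h1, by omega⟩, rfl⟩
    · rintro ⟨j, ⟨h1, h2⟩, rfl⟩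
      exact hbetween j h1 (by omega)
  have hbn := (hmemT.1 hb).1
  have hcard : b + 1 - a = t := by
    rw [← hU.1, hUeq, card_window]
    refine hinj.mono fun x hx => ?_
    rw [Set.mem_Ico] at hx
    rw [Set.mem_Iio]
    omega
  rw [hcard] at hUeq
  exact ⟨a, by omega, hUeq⟩

/-- On a path with at most `2t` vertices any two windows overlap or touch, so their union
contains every window in between. -/
theorem isGeneratorChain_of_path (ht : 1 ≤ t) (hn : n ≤ 2 * t) (hinj : Set.InjOn f (Set.Iio n))
    (hsurj : ∀ v, ∃ i < n, f i = v) (hadj : ∀ i, i + 1 < n → G.Adj (f i) (f (i + 1)))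
    (hstep : ∀ i j, i < j → j < n → G.Adj (f i) (f j) → j = i + 1) :
    IsGeneratorChain (connectedIdeal k G t) (fun i => squarefreeExp (window f i t))
      (n + 1 - t) where
  minGens_eq := by
    rw [minGens_connectedIdeal]
    ext m
    constructor
    · rintro ⟨U, hU, rfl⟩
      obtain ⟨i, hi, rfl⟩ := hU.exists_eq_window ht hinj hsurj hstep
      exact ⟨i, by rw [Set.mem_Iio]; omega, rfl⟩
    · rintro ⟨i, hi, rfl⟩
      rw [Set.mem_Iio] at hi
      refine ⟨_, isConnectedOfCard_window ht (hinj.mono fun x hx => ?_)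
        fun j _ hj => hadj j (by omega), rfl⟩
      rw [Set.mem_Ico] at hx
      rw [Set.mem_Iio]
      omega
  injOn := by
    intro i hi j hj h
    rw [Set.mem_Iio] at hi hj
    exact window_injOn ht hinj (by omega) (by omega) (squarefreeExp_injective h)
  le_sup := by
    intro i m j him hmj hj
    simp only [squarefreeExp_sup, squarefreeExp_le_iff]
    intro v hv
    obtain ⟨x, hx, rfl⟩ := mem_window.1 hv
    rw [Finset.mem_union]
    rcases lt_or_ge x (i + t) with h | h
    · exact Or.inl (apply_mem_window (by omega) h)
    · exact Or.inr (apply_mem_window (by omega) (by omega))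
  eq_or_eq := by
    intro i m hi hm h
    simp only [squarefreeExp_sup, squarefreeExp_le_iff] at h
    have h1 := h (apply_mem_window (le_refl m) (by omega))
    have h2 := h (apply_mem_window (show m ≤ m + t - 1 by omega) (by omega))
    rw [Finset.mem_union, apply_mem_window_iff hinj (by omega) (by omega),
      apply_mem_window_iff hinj (by omega) (by omega)] at h1 h2
    omega

end Path

/-! ### Long paths and cycles -/

section Obstruction

open scoped Classical

variable {V : Type*} {k : Type*} [Field k] {r : (V →₀ ℕ) → (V →₀ ℕ) → Prop}
  [IsStrictTotalOrder (V →₀ ℕ) r] {G : SimpleGraph V} {t n : ℕ} {f : ℕ → V}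

/-- In an induced path on `2t + 1` vertices the first and the last window cover all but the
middle vertex. The edge between them closes a cycle of the Scarf complex, but lies in no
triangle, since a third generator below contains the middle vertex. -/
theorem IsScarf.not_long_path (hS : IsScarf r (connectedIdeal k G t)) (ht : 2 ≤ t)
    (hinj : Set.InjOn f (Set.Iio (2 * t + 1)))
    (hadj : ∀ i, i + 1 < 2 * t + 1 → G.Adj (f i) (f (i + 1)))
    (hstep : ∀ i j, i < j → j < 2 * t + 1 → G.Adj (f i) (f j) → j = i + 1) : False := by
  have hinj' : ∀ {i s}, i + s ≤ 2 * t + 1 → Set.InjOn f (Set.Ico i (i + s)) := fun h =>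
    hinj.mono fun x hx => by rw [Set.mem_Ico] at hx; rw [Set.mem_Iio]; omega
  have hW : ∀ {i}, i ≤ t + 1 → IsConnectedOfCard G t (window f i t) := fun hi =>
    isConnectedOfCard_window (by omega) (hinj' (by omega)) fun j _ hj => hadj j (by omega)
  have hWne : ∀ {i j}, i ≤ t + 1 → j ≤ t + 1 → i ≠ j → window f i t ≠ window f j t :=
    fun hi hj hij h => hij (window_injOn (by omega) hinj (by omega) (by omega) h)
  have hends : ∀ D, IsConnectedOfCard G t D → D ⊆ window f 0 t ∪ window f (t + 1) t →
      D = window f 0 t ∨ D = window f (t + 1) t := by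
    intro D hD hsub
    by_cases h0 : D ⊆ window f 0 t
    · exact Or.inl (hD.eq_of_subset (hW (by omega)) h0)
    by_cases h1 : D ⊆ window f (t + 1) t
    · exact Or.inr (hD.eq_of_subset (hW le_rfl) h1)
    exfalso
    obtain ⟨y, hyD, hy⟩ := Finset.not_subset.1 h0
    obtain ⟨x, hxD, hx⟩ := Finset.not_subset.1 h1
    have hx0 := (Finset.mem_union.1 (hsub hxD)).resolve_right hx
    obtain ⟨u, -, hu, v, hvD, hv, huv⟩ := exists_adj_of_induce_connected hD.2
      (S := (window f 0 t : Set V)) hxD hyD hx0 hy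
    have hv1 := (Finset.mem_union.1 (hsub hvD)).resolve_left hv
    obtain ⟨i, hi, rfl⟩ := mem_window.1 (Finset.mem_coe.1 hu)
    obtain ⟨j, hj, rfl⟩ := mem_window.1 hv1
    have := hstep i j (by omega) (by omega) huv
    omega
  obtain ⟨x, hx0, hx1, hxa, hface⟩ := hS.exists_triangle_of_cycle
    (p := fun i => squarefreeExp (window f i t))
    (a := squarefreeExp (window f 0 (2 * t + 1))) (m := t + 1) (by omega)
    (fun i hi j hj h => by
      by_contra hij
      exact hWne hi hj hij (squarefreeExp_injective h))
    (fun i hi => hS.pair_mem (by omega) (card_window (hinj' (i := i) (by omega)))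
      (hW (by omega)) (hW (by omega)) (window_subset_window f le_rfl (by omega))
      (window_subset_window f (by omega) (by omega)) (hWne (by omega) (by omega) (by omega)))
    (fun i hi => squarefreeExp_le_iff.2 (window_subset_window f (by omega) (by omega)))
    ((pair_mem_scarfComplex_connectedIdeal_iff (hW (by omega)) (hW le_rfl)
      (hWne (by omega) le_rfl (by omega))).2 hends)
  obtain ⟨D, hD, rfl⟩ := exists_of_mem_minGens ((mem_scarfComplex_iff.1 hface).1
    (show x ∈ _ by simp))
  rw [squarefreeExp_le_iff] at hxa
  have hmid : f t ∈ D := by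
    by_contra hmid
    refine (hends D hD fun v hv => ?_).elim (fun h => hx0 (h ▸ rfl)) fun h => hx1 (h ▸ rfl)
    obtain ⟨j, hj, rfl⟩ := mem_window.1 (hxa hv)
    rw [Finset.mem_union]
    rcases lt_trichotomy j t with h | rfl | h
    · exact Or.inl (apply_mem_window (by omega) (by omega))
    · exact absurd hv hmid
    · exact Or.inr (apply_mem_window (by omega) (by omega))
  -- The triangle now lies over all `2t + 1` vertices, so it contains every window.
  have hall : ∀ i, i ≠ 0 → i < t + 1 → window f i t = D := by
    intro i h0 hi
    refine ((eq_or_eq_or_eq_of_triple_mem hface (hW hi.le) fun v hv => ?_).resolve_left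
      (hWne hi.le (by omega) h0)).resolve_left (hWne hi.le le_rfl hi.ne)
    obtain ⟨j, hj, rfl⟩ := mem_window.1 hv
    rw [Finset.mem_union, Finset.mem_union]
    rcases lt_trichotomy j t with h | rfl | h
    · exact Or.inl (apply_mem_window (by omega) (by omega))
    · exact Or.inr (Or.inr hmid)
    · exact Or.inr (Or.inl (apply_mem_window (by omega) (by omega)))
  exact hWne (i := 1) (j := 2) (by omega) (by omega) (by omega)
    ((hall 1 (by omega) (by omega)).trans (hall 2 (by omega) (by omega)).symm)

/-- The windows of a cycle on `n` vertices with `t + 2 ≤ n ≤ 2t + 1` form a cycle of the Scarf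
complex. It has no triangle on the edge of the windows `0` and `n - 1`: a third generator must
contain one of the vertices next to the arc they cover, which makes it the neighbouring window,
and then the window between two others is redundant. -/
theorem IsScarf.not_cycle (hS : IsScarf r (connectedIdeal k G t)) (ht : 2 ≤ t)
    (hn1 : t + 2 ≤ n) (hn2 : n ≤ 2 * t + 1)
    (hinj : ∀ i j, i < j → j < i + n → f i ≠ f j) (hper : ∀ i, f (i + n) = f i)
    (hsurj : ∀ v, ∃ i < n, f i = v) (hadj : ∀ i, G.Adj (f i) (f (i + 1)))
    (hstep : ∀ i j, i < j → j < n → G.Adj (f i) (f j) → j = i + 1 ∨ (i = 0 ∧ j + 1 = n)) :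
    False := by
  have hinj' : ∀ {i s}, s ≤ n → Set.InjOn f (Set.Ico i (i + s)) := by
    intro i s hs x hx y hy hxy
    rw [Set.mem_Ico] at hx hy
    by_contra hne
    rcases Nat.lt_or_gt_of_ne hne with h | h
    · exact hinj x y h (by omega) hxy
    · exact hinj y x h (by omega) hxy.symm
  have hW : ∀ i, IsConnectedOfCard G t (window f i t) := fun i =>
    isConnectedOfCard_window (by omega) (hinj' (by omega)) fun j _ _ => hadj j
  have hmem : ∀ {i j}, i < n → j < n →
      (f j ∈ window f i t ↔ (i ≤ j ∧ j < i + t) ∨ j + n < i + t) := by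
    intro i j hi hj
    rw [mem_window]
    constructor
    · rintro ⟨l, hl, heq⟩
      rcases lt_trichotomy l j with h | rfl | h
      · exact absurd heq (hinj l j h (by omega))
      · exact Or.inl hl
      · rcases lt_trichotomy l (j + n) with h' | rfl | h'
        · exact absurd heq.symm (hinj j l h h')
        · exact Or.inr hl.2
        · rw [← hper j] at heq
          exact absurd heq.symm (hinj (j + n) l h' (by omega))
    · rintro (h | h)
      · exact ⟨j, h, rfl⟩
      · exact ⟨j + n, ⟨by omega, h⟩, hper j⟩
  have hlt : ∀ {i j}, i < j → j < n → window f i t ≠ window f j t := by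
    intro i j hij hj h
    have h1 := hmem (i := i) (j := i) (by omega) (by omega)
    have h2 := hmem (i := i) (j := j) (by omega) (by omega)
    have h3 := hmem (i := i) (j := j - 1) (by omega) (by omega)
    rw [h, hmem hj (by omega)] at h1 h2 h3
    omega
  have hWne : ∀ {i j}, i < n → j < n → i ≠ j → window f i t ≠ window f j t := by
    intro i j hi hj hij
    rcases Nat.lt_or_gt_of_ne hij with h | h
    · exact hlt h hj
    · exact (hlt h hi).symm
  have hWper : window f n t = window f 0 t := by
    ext v
    rw [mem_window, mem_window]
    constructor
    · rintro ⟨l, hl, rfl⟩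
      exact ⟨l - n, by omega, by rw [← hper, Nat.sub_add_cancel hl.1]⟩
    · rintro ⟨l, hl, rfl⟩
      exact ⟨l + n, by omega, hper l⟩
  have hpair : ∀ i, window f i t ≠ window f (i + 1) t →
      {squarefreeExp (window f i t), squarefreeExp (window f (i + 1) t)} ∈
        scarfComplex (connectedIdeal k G t) := fun i hne =>
    hS.pair_mem (by omega) (card_window (hinj' (i := i) (by omega))) (hW i) (hW (i + 1))
      (window_subset_window f le_rfl (by omega))
      (window_subset_window f (by omega) (by omega)) hne
  have hends : {squarefreeExp (window f 0 t), squarefreeExp (window f (n - 1) t)} ∈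
      scarfComplex (connectedIdeal k G t) := by
    have := hpair (n - 1) (by
      rw [Nat.sub_add_cancel (by omega), hWper]
      exact hWne (by omega) (by omega) (by omega))
    rwa [Nat.sub_add_cancel (by omega), hWper, Finset.pair_comm] at this
  have hne0 : window f 0 t ≠ window f (n - 1) t := hWne (by omega) (by omega) (by omega)
  obtain ⟨x, hx0, hx1, -, hface⟩ := hS.exists_triangle_of_cycle
    (p := fun i => squarefreeExp (window f i t))
    (a := squarefreeExp (window f 0 n)) (m := n - 1) (by omega)
    (fun i hi j hj h => by
      rw [Set.mem_Iic] at hi hj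
      by_contra hij
      exact hWne (by omega) (by omega) hij (squarefreeExp_injective h))
    (fun i hi => hpair i (hWne (by omega) (by omega) (by omega)))
    (fun i _ => squarefreeExp_le_iff.2 fun v _ => by
      obtain ⟨j, hj, rfl⟩ := hsurj v
      exact apply_mem_window (by omega) (by omega))
    hends
  obtain ⟨D, hD, rfl⟩ := exists_of_mem_minGens ((mem_scarfComplex_iff.1 hface).1
    (show x ∈ _ by simp))
  have hD0 : window f 0 t ≠ D := fun h => hx0 (h ▸ rfl)
  have hD1 : window f (n - 1) t ≠ D := fun h => hx1 (h ▸ rfl)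
  rw [pair_mem_scarfComplex_connectedIdeal_iff (hW _) (hW _) hne0] at hends
  -- The arc left uncovered by the two windows has at most `t` vertices, so `D` either fills it
  -- or leaves it through one of its ends.
  have hgap : f t ∈ D ∨ f (n - 2) ∈ D := by
    obtain ⟨v, hvD, hv⟩ : ∃ v ∈ D, v ∉ window f 0 t ∪ window f (n - 1) t := by
      refine Finset.not_subset.1 fun hsub => ?_
      exact (hends D hD hsub).elim (fun h => hD0 h.symm) fun h => hD1 h.symm
    obtain ⟨j, hj, rfl⟩ := hsurj v
    rw [Finset.mem_union, hmem (by omega) hj, hmem (by omega) hj] at hv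
    have hjgap : f j ∈ window f t (n - 1 - t) := apply_mem_window (by omega) (by omega)
    by_cases hsub : D ⊆ window f t (n - 1 - t)
    · left
      have hcard := card_window (hinj' (i := t) (show n - 1 - t ≤ n by omega))
      rw [Finset.eq_of_subset_of_card_le hsub (by rw [hcard, hD.1]; omega)]
      exact apply_mem_window le_rfl (by omega)
    · obtain ⟨y, hyD, hy⟩ := Finset.not_subset.1 hsub
      obtain ⟨u, huD, hu, w, hwD, hw, huw⟩ := exists_adj_of_induce_connected hD.2
        (S := (window f t (n - 1 - t) : Set V)) hvD hyD hjgap hy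
      obtain ⟨a, ha, rfl⟩ := mem_window.1 (Finset.mem_coe.1 hu)
      obtain ⟨b, hb, rfl⟩ := hsurj w
      have hb' : ¬(t ≤ b ∧ b < t + (n - 1 - t)) := fun h => hw (apply_mem_window h.1 h.2)
      rcases lt_trichotomy a b with h | rfl | h
      · have := hstep a b h hb huw
        right
        rwa [show n - 2 = a by omega]
      · exact absurd huw (G.loopless.irrefl _)
      · have := hstep b a h (by omega) huw.symm
        left
        rwa [show t = a by omega]
  rcases hgap with hgap | hgap
  · have hD' : window f 1 t = D := by
      refine ((eq_or_eq_or_eq_of_triple_mem hface (hW 1) fun v hv => ?_).resolve_left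
        (hWne (by omega) (by omega) (by omega))).resolve_left
        (hWne (by omega) (by omega) (by omega))
      obtain ⟨j, hj, rfl⟩ := mem_window.1 hv
      rw [Finset.mem_union, Finset.mem_union]
      rcases eq_or_ne j t with rfl | h
      · exact Or.inr (Or.inr hgap)
      · exact Or.inl (apply_mem_window (by omega) (by omega))
    subst hD'
    refine not_subset_of_triple_mem hface hne0 hD0 fun v hv => ?_
    obtain ⟨j, hj, rfl⟩ := mem_window.1 hv
    rw [Finset.mem_union, hmem (by omega) (by omega), hmem (by omega) (by omega)]
    omega
  · have hD' : window f (n - 2) t = D := by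
      refine ((eq_or_eq_or_eq_of_triple_mem hface (hW (n - 2)) fun v hv => ?_).resolve_left
        (hWne (by omega) (by omega) (by omega))).resolve_left
        (hWne (by omega) (by omega) (by omega))
      obtain ⟨j, hj, rfl⟩ := mem_window.1 hv
      rw [Finset.mem_union, Finset.mem_union]
      rcases eq_or_ne j (n - 2) with rfl | h
      · exact Or.inr (Or.inr hgap)
      · exact Or.inr (Or.inl (apply_mem_window (by omega) (by omega)))
    subst hD'
    rw [Finset.insert_comm] at hface
    refine not_subset_of_triple_mem hface hne0.symm hD1 fun v hv => ?_
    obtain ⟨j, hj, rfl⟩ := hsurj v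
    rw [hmem (by omega) hj] at hv
    rw [Finset.mem_union, hmem (by omega) hj, hmem (by omega) hj]
    omega

end Obstruction

/-! ### Graphs of maximum degree two -/

section MaxDegreeTwo

open scoped Classical

variable {V : Type*} {G : SimpleGraph V}

/-- An enumeration of the vertices in which exactly the consecutive ones are adjacent identifies
the graph with a path graph. -/
theorem nonempty_iso_pathGraph {n : ℕ} {f : ℕ → V} (hinj : Set.InjOn f (Set.Iio n))
    (hsurj : ∀ v, ∃ i < n, f i = v) (hadj : ∀ i, i + 1 < n → G.Adj (f i) (f (i + 1)))
    (hstep : ∀ i j, i < j → j < n → G.Adj (f i) (f j) → j = i + 1) :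
    Nonempty (G ≃g SimpleGraph.pathGraph n) := by
  let e : Fin n ≃ V := Equiv.ofBijective (fun i => f i)
    ⟨fun i j h => Fin.ext (hinj i.2 j.2 h), fun v => by
      obtain ⟨i, hi, rfl⟩ := hsurj v
      exact ⟨⟨i, hi⟩, rfl⟩⟩
  refine ⟨SimpleGraph.Iso.symm ⟨e, fun {i j} => ?_⟩⟩
  rw [SimpleGraph.pathGraph_adj]
  change G.Adj (f i) (f j) ↔ _
  constructor
  · intro h
    rcases lt_trichotomy i.1 j.1 with hij | hij | hij
    · exact Or.inl (hstep _ _ hij j.2 h).symm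
    · rw [hij] at h
      exact absurd h (G.loopless.irrefl _)
    · exact Or.inr (hstep _ _ hij i.2 h.symm).symm
  · rintro (h | h)
    · rw [← h]
      exact hadj _ (h ▸ j.2)
    · rw [← h]
      exact (hadj _ (h ▸ i.2)).symm

variable [Fintype V]

/-- The vertices of a connected graph of maximum degree at most two can be listed along a path,
a longest one, so that the only further adjacency can be that of its two ends. -/
theorem SimpleGraph.Connected.exists_path_enumeration (hG : G.Connected)
    (hdeg : ∀ v a b c, G.Adj v a → G.Adj v b → G.Adj v c → a = b ∨ a = c ∨ b = c) :
    ∃ f : ℕ → V, Set.InjOn f (Set.Iio (Fintype.card V)) ∧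
      (∀ v, ∃ i < Fintype.card V, f i = v) ∧
      (∀ i, i + 1 < Fintype.card V → G.Adj (f i) (f (i + 1))) ∧
      ∀ i j, i < j → j < Fintype.card V → G.Adj (f i) (f j) →
        j = i + 1 ∨ (i = 0 ∧ j + 1 = Fintype.card V) := by
  let Q : ℕ → Prop := fun m => ∃ f : ℕ → V, Set.InjOn f (Set.Iio m) ∧
    ∀ i, i + 1 < m → G.Adj (f i) (f (i + 1))
  have hbound : ∀ m, Q m → m ≤ Fintype.card V := by
    rintro m ⟨f, hf, -⟩
    have := Finset.card_le_univ ((Finset.range m).image f)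
    rwa [Finset.card_image_of_injOn (by simpa [Set.Iio] using hf), Finset.card_range] at this
  obtain ⟨v₀⟩ := hG.nonempty
  have hone : Q 1 := ⟨fun _ => v₀, fun i hi j hj _ => by
    rw [Set.mem_Iio] at hi hj; omega, fun i hi => by omega⟩
  set n := Nat.findGreatest Q (Fintype.card V) with hn
  obtain ⟨f, hinj, hadj⟩ : Q n := Nat.findGreatest_spec (hbound 1 hone) hone
  have hmax : ¬Q (n + 1) := fun h =>
    absurd (Nat.le_findGreatest (hbound _ h) h) (by omega)
  have hn1 : 1 ≤ n := Nat.le_findGreatest (hbound 1 hone) hone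
  have hinj' : ∀ {i j}, i < n → j < n → f i = f j → i = j := fun hi hj h => hinj hi hj h
  have hinterior : ∀ {i w}, 0 < i → i + 1 < n → G.Adj (f i) w →
      w = f (i - 1) ∨ w = f (i + 1) := by
    intro i w hi hi1 hw
    have h1 := hadj (i - 1) (by omega)
    rw [Nat.sub_add_cancel hi] at h1
    rcases hdeg _ _ _ _ hw h1.symm (hadj i hi1) with h | h | h
    · exact Or.inl h
    · exact Or.inr h
    · exact absurd (hinj' (by omega) hi1 h) (by omega)
  have hclosed : ∀ {i w}, i < n → G.Adj (f i) w → ∃ j < n, f j = w := by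
    intro i w hi hw
    by_contra! hnew
    rcases Nat.lt_or_ge (i + 1) n with hlast | hlast
    · rcases Nat.eq_zero_or_pos i with rfl | hpos
      · refine hmax ⟨fun m => Nat.casesOn m w f, ?_, ?_⟩
        · intro a ha b hb hab
          rw [Set.mem_Iio] at ha hb
          match a, b with
          | 0, 0 => rfl
          | 0, b + 1 => exact absurd hab.symm (hnew b (by omega))
          | a + 1, 0 => exact absurd hab (hnew a (by omega))
          | a + 1, b + 1 => exact congrArg _ (hinj' (by omega) (by omega) hab)
        · intro a ha
          match a with
          | 0 => exact hw.symm
          | a + 1 => exact hadj a (by omega)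
      · rcases hinterior hpos hlast hw with h | h
        · exact hnew _ (by omega) h.symm
        · exact hnew _ hlast h.symm
    · obtain rfl : i = n - 1 := by omega
      refine hmax ⟨Function.update f n w, ?_, ?_⟩
      · intro a ha b hb hab
        rw [Set.mem_Iio] at ha hb
        rcases eq_or_ne a n with han | han <;> rcases eq_or_ne b n with hbn | hbn
        · omega
        · rw [han, Function.update_self, Function.update_of_ne hbn] at hab
          exact absurd hab.symm (hnew b (by omega))
        · rw [hbn, Function.update_self, Function.update_of_ne han] at hab
          exact absurd hab (hnew a (by omega))
        · rw [Function.update_of_ne han, Function.update_of_ne hbn] at hab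
          exact hinj' (by omega) (by omega) hab
      · intro a ha
        rw [Function.update_of_ne (by omega)]
        rcases eq_or_ne (a + 1) n with h | h
        · rw [h, Function.update_self, show a = n - 1 by omega]
          exact hw
        · rw [Function.update_of_ne h]
          exact hadj a (by omega)
  have hsurj : ∀ v, ∃ i < n, f i = v := by
    intro v
    by_contra hv
    obtain ⟨_, ⟨i, hi, rfl⟩, w, hw, hiw⟩ := hG.exists_adj_mem_notMem (S := f '' Set.Iio n)
      (u := f 0) (v := v) ⟨0, by rw [Set.mem_Iio]; omega, rfl⟩ fun ⟨i, hi, h⟩ => hv ⟨i, hi, h⟩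
    obtain ⟨j, hj, rfl⟩ := hclosed hi hiw
    exact hw ⟨j, hj, rfl⟩
  have hcard : n = Fintype.card V := by
    refine le_antisymm (hbound n ⟨f, hinj, hadj⟩) ?_
    have huniv : (Finset.range n).image f = Finset.univ := by
      refine Finset.eq_univ_of_forall fun v => ?_
      obtain ⟨i, hi, rfl⟩ := hsurj v
      exact Finset.mem_image_of_mem f (Finset.mem_range.2 hi)
    rw [← Finset.card_univ, ← huniv]
    simpa using Finset.card_image_le (s := Finset.range n) (f := f)
  rw [← hcard]
  refine ⟨f, hinj, hsurj, hadj, fun i j hij hj h => ?_⟩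
  by_contra! hcon
  rcases Nat.eq_zero_or_pos i with rfl | hi
  · rcases hinterior (by omega) (by omega) h.symm with h | h
    · have := hinj' (by omega) (by omega) h
      omega
    · have := hinj' (by omega) (by omega) h
      omega
  · rcases hinterior hi (by omega) h with h | h
    · have := hinj' (by omega) (by omega) h
      omega
    · have := hinj' (by omega) (by omega) h
      omega

end MaxDegreeTwo

/-! ### The classification -/

section Classification

open scoped Classical

variable {V : Type*} {k : Type*} [Field k] {r : (V →₀ ℕ) → (V →₀ ℕ) → Prop}
  [IsStrictTotalOrder (V →₀ ℕ) r] {G : SimpleGraph V} {t : ℕ}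

theorem isScarf_of_iso_pathGraph (ht : 1 ≤ t) {n : ℕ} (hn : n ≤ 2 * t)
    (e : G ≃g SimpleGraph.pathGraph n) (hV : Nonempty V) : IsScarf r (connectedIdeal k G t) := by
  let f : ℕ → V := fun i => if h : i < n then e.symm ⟨i, h⟩ else Classical.arbitrary V
  have hf : ∀ {i} (hi : i < n), f i = e.symm ⟨i, hi⟩ := fun hi => dif_pos hi
  have hfadj : ∀ {i j}, i < n → j < n → (G.Adj (f i) (f j) ↔ i + 1 = j ∨ j + 1 = i) := by
    intro i j hi hj
    rw [hf hi, hf hj, e.symm.map_adj_iff, SimpleGraph.pathGraph_adj]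
  refine (isGeneratorChain_of_path (f := f) ht hn ?_ ?_ ?_ ?_).supportsResolution
    (zero_notMem_minGens_connectedIdeal (by omega)) span_minGens_connectedIdeal
  · intro i hi j hj h
    rw [hf hi, hf hj] at h
    exact congrArg Fin.val (e.symm.injective h)
  · intro v
    refine ⟨(e v).1, (e v).2, ?_⟩
    rw [hf (e v).2]
    exact e.symm_apply_apply v
  · intro i hi
    exact (hfadj (by omega) hi).2 (Or.inl rfl)
  · intro i j hij hj h
    have := (hfadj (by omega) hj).1 h
    omega

variable [Fintype V]

theorem isScarf_of_card_le (hG : G.Connected) (ht : t ≠ 0) (h : Fintype.card V ≤ t) :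
    IsScarf r (connectedIdeal k G t) := by
  refine IsGeneratorChain.supportsResolution (P := fun _ => squarefreeExp Finset.univ)
    (q := if Fintype.card V = t then 1 else 0) ⟨?_, ?_, fun _ _ _ _ _ _ => le_sup_left, ?_⟩
    (zero_notMem_minGens_connectedIdeal ht) span_minGens_connectedIdeal
  · rw [minGens_connectedIdeal]
    have huniv : ∀ U : Finset V, IsConnectedOfCard G t U → Fintype.card V = t ∧ U = Finset.univ := by
      intro U hU
      have h1 := Finset.card_le_univ U
      rw [hU.1] at h1
      exact ⟨le_antisymm h h1, (Finset.card_eq_iff_eq_univ U).1 (hU.1.trans (le_antisymm h1 h))⟩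
    ext m
    constructor
    · rintro ⟨U, hU, rfl⟩
      obtain ⟨hcard, rfl⟩ := huniv U hU
      exact ⟨0, by simp [hcard], rfl⟩
    · rintro ⟨i, hi, rfl⟩
      have hcard : Fintype.card V = t := by
        by_contra hne
        simp [hne] at hi
      refine ⟨Finset.univ, ⟨hcard, ?_⟩, rfl⟩
      rw [Finset.coe_univ]
      exact (SimpleGraph.induceUnivIso G).connected_iff.2 hG
  · intro i hi j hj _
    rw [Set.mem_Iio] at hi hj
    split_ifs at hi hj <;> omega
  · intro i m hi
    split_ifs at hi <;> omega

/-- If the Scarf complex is a resolution and `G` has more than `t` vertices, then `G` is a path or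
a cycle; a path on at most `2t` vertices is the only case without an obstruction. -/
theorem IsScarf.card_le_or_iso_pathGraph (hS : IsScarf r (connectedIdeal k G t))
    (hG : G.Connected) (ht : 3 ≤ t) : Fintype.card V ≤ t ∨
      ∃ l : ℕ, l ≤ 2 * t ∧ Nonempty (G ≃g SimpleGraph.pathGraph l) := by
  refine or_iff_not_imp_left.2 fun hcard => ?_
  obtain ⟨f, hinj, hsurj, hadj, hstep⟩ := hG.exists_path_enumeration (by
    intro v a b c hva hvb hvc
    by_contra! h
    exact hS.not_three_neighbors hG ht (by omega) hva hvb hvc h.1 h.2.1 h.2.2)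
  set n := Fintype.card V with hn
  by_cases hclose : G.Adj (f 0) (f (n - 1))
  · exfalso
    rcases lt_or_ge (2 * t + 1) n with hlong | hshort
    · refine hS.not_long_path (f := f) (by omega) (hinj.mono fun x hx => ?_)
        (fun i hi => hadj i (by omega)) fun i j hij hj h => ?_
      · rw [Set.mem_Iio] at hx ⊢
        omega
      · have := hstep i j hij (by omega) h
        omega
    -- Wrapping the enumeration around turns the closed path into a periodic sequence.
    let g : ℕ → V := fun i => f (i % n)
    have hmod : ∀ i, i % n < n := fun i => Nat.mod_lt i (by omega)
    have hgf : ∀ {i}, i < n → g i = f i := fun hi => congrArg f (Nat.mod_eq_of_lt hi)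
    have hgper : ∀ i, g (i + n) = g i := fun i => congrArg f (Nat.add_mod_right i n)
    have hginj : ∀ i j, i < j → j < i + n → g i ≠ g j := by
      intro i j hij hj h
      have hmodeq : i ≡ j [MOD n] := hinj (hmod i) (hmod j) h
      have := Nat.le_of_dvd (by omega) ((Nat.modEq_iff_dvd' hij.le).1 hmodeq)
      omega
    have hgadj : ∀ i, G.Adj (g i) (g (i + 1)) := by
      intro i
      change G.Adj (f (i % n)) (f ((i + 1) % n))
      have hi := hmod i
      rcases eq_or_ne (i % n + 1) n with h | h
      · rw [Nat.add_mod, Nat.mod_eq_of_lt (show 1 < n by omega), h, Nat.mod_self,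
          show i % n = n - 1 by omega]
        exact hclose.symm
      · rw [Nat.add_mod, Nat.mod_eq_of_lt (show 1 < n by omega),
          Nat.mod_eq_of_lt (show i % n + 1 < n by omega)]
        exact hadj _ (by omega)
    rcases eq_or_ne n (t + 1) with hsmall | hne
    · have hginj' : ∀ i, Set.InjOn g (Set.Ico i (i + t)) := by
        intro i x hx y hy hxy
        rw [Set.mem_Ico] at hx hy
        by_contra hne
        rcases Nat.lt_or_gt_of_ne hne with h | h
        · exact hginj x y h (by omega) hxy
        · exact hginj y x h (by omega) hxy.symm
      have hW : ∀ i, IsConnectedOfCard G t (window g i t) := fun i =>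
        isConnectedOfCard_window (by omega) (hginj' i) fun j _ _ => hgadj j
      have hdiff : ∀ i j, i < j → j < 3 → window g i t ≠ window g j t := by
        intro i j hij hj h
        have : g (j - 1) ∈ window g j t :=
          h ▸ apply_mem_window (by omega) (by omega)
        obtain ⟨l, hl, heq⟩ := mem_window.1 this
        exact hginj (j - 1) l (by omega) (by omega) heq.symm
      exact hS.not_three_connected (H := Finset.univ) (by omega)
        (by rw [Finset.card_univ]; exact hsmall) (hW 0) (hW 1) (hW 2) (Finset.subset_univ _)
        (Finset.subset_univ _) (Finset.subset_univ _) (hdiff 0 1 (by omega) (by omega))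
        (hdiff 0 2 (by omega) (by omega)) (hdiff 1 2 (by omega) (by omega))
    · refine hS.not_cycle (f := g) (n := n) (by omega) (by omega) hshort hginj hgper
        (fun v => ?_) hgadj fun i j hij hj h => ?_
      · obtain ⟨i, hi, rfl⟩ := hsurj v
        exact ⟨i, hi, hgf hi⟩
      · rw [hgf (by omega), hgf hj] at h
        exact hstep i j hij hj h
  · have hstep' : ∀ i j, i < j → j < n → G.Adj (f i) (f j) → j = i + 1 := by
      intro i j hij hj h
      refine (hstep i j hij hj h).resolve_right ?_
      rintro ⟨rfl, hjn⟩
      rw [show j = n - 1 by omega] at h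
      exact hclose h
    rcases lt_or_ge (2 * t) n with hlong | hshort
    · exfalso
      refine hS.not_long_path (f := f) (by omega) (hinj.mono fun x hx => ?_)
        (fun i hi => hadj i (by omega)) fun i j hij hj h => hstep' i j hij (by omega) h
      rw [Set.mem_Iio] at hx ⊢
      omega
    · exact ⟨n, hshort, nonempty_iso_pathGraph hinj hsurj hadj hstep'⟩

end Classification

theorem theoremA {V : Type*} [Fintype V] (k : Type*) [Field k]
    (r : (V →₀ ℕ) → (V →₀ ℕ) → Prop) [IsStrictTotalOrder (V →₀ ℕ) r]
    (G : SimpleGraph V) (hG : G.Connected) (t : ℕ) (ht : 3 ≤ t) :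
    (IsMinimallyResolvedByScarf r (connectedIdeal k G t) ↔
      (Fintype.card V ≤ t ∨
        ∃ l : ℕ, l ≤ 2 * t ∧ Nonempty (G ≃g SimpleGraph.pathGraph l))) ∧
    (IsScarf r (connectedIdeal k G t) ↔
      (Fintype.card V ≤ t ∨
        ∃ l : ℕ, l ≤ 2 * t ∧ Nonempty (G ≃g SimpleGraph.pathGraph l))) := by
  have key : IsScarf r (connectedIdeal k G t) ↔ (Fintype.card V ≤ t ∨
      ∃ l : ℕ, l ≤ 2 * t ∧ Nonempty (G ≃g SimpleGraph.pathGraph l)) := by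
    refine ⟨fun hS => hS.card_le_or_iso_pathGraph hG ht, ?_⟩
    rintro (h | ⟨l, hl, ⟨e⟩⟩)
    · exact isScarf_of_card_le hG (by omega) h
    · exact isScarf_of_iso_pathGraph (by omega) hl e hG.nonempty
  exact ⟨(and_iff_left isMinimalComplex_scarfComplex).trans key, key⟩
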